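/- Let $\mathcal X=\{1,2,\dots\}$ and let $\mathcal P(\mathcal X)$ be the set of probability distributions on $\mathcal X$. For $P\in\mathcal P(\mathcal X)$ let $P^{\downarrow}$ be its decreasing rearrangement. A function $\phi:\mathcal P(\mathcal X)\to[0,\infty]$ is symmetric if $\phi(P)=\phi(P^\downarrow)$ for all $P$; concave if $\phi(\lambda P+(1-\lambda)P')\ge\lambda\phi(P)+(1-\lambda)\phi(P')$ for all $P,P'$ and $0\le\lambda\le1$; lower semicontinuous if $\liminf_n\phi(P_n)\ge\phi(P)$ whenever $P_n\to P$ pointwise. Its concavity is strict if the concavity inequality is strict whenever $P\ne P'$, $0<\lambda<1$ and $\phi(P),\phi(P')<\infty$. For an $\mathcal X$-valued random variable $X$ and a $\mathcal Y$-valued random variable $Y$ ($\mathcal Y$ a measurable space), let $P_{X|Y}$ be the regular conditional distribution of $X$ given $Y$, put $\mathfrak h_\phi(X\mid Y)=\mathbb E[\phi(P_{X|Y})]$, and let $P_{\mathrm e}^{(L)}(X\mid Y)=\min_f\mathbb P\{X\notin f(Y)\}$, the minimum being over the measurable maps $f$ from $\mathcal Y$ to the nonempty subsets of $\mathcal X$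 with at most $L$ elements. For $Q\in\mathcal P(\mathcal X)$ put $P_{\mathrm e}^{(L)}(Q)=1-\sum_{x=1}^LQ^\downarrow(x)$. Let $Q\in\mathcal P(\mathcal X)$, let $L\ge1$ be an integer, let $\varepsilon$ be real, and let $\mathcal Y$ be a set with $$1-\sum_{x=1}^{\#(\mathcal Y)L}Q^\downarrow(x)\le\varepsilon\le P_{\mathrm e}^{(L)}(Q),$$ where $\#(\mathcal Y)\in\{0,1,\dots,\infty\}$ is the number of elements of $\mathcal Y$. For $j\ge1$ let $\mathcal V(j)=\frac{(1-\varepsilon)-\sum_{x=1}^{j-1}Q^\downarrow(x)}{L-j+1}$ if $j\le L$ and $\mathcal V(j)=1$ if $j>L$. For $L\le k\le\infty$ let $\mathcal W(L)=-1$, $\mathcal W(k)=\frac{\sum_{x=1}^kQ^\downarrow(x)-(1-\varepsilon)}{k-L}$ if $L<k<\infty$, and $\mathcal W(\infty)=0$. Let $J=\min\{j\ge1: Q^\downarrow(j)<\mathcal V(j)\}$ and $K_1=\sup\{L\le k<\infty:\mathcal W(k)<Q^\downarrow(k)\}\in\{L,L+1,\dots,\infty\}$. The type-1 Fano distribution is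 $$P_1(x)=\begin{cases}Q^\downarrow(x)&\text{if }1\le x<J\text{ or }K_1<x<\infty,\\ \mathcal V(J)&\text{if }J\le x\le L,\\ \mathcal W(K_1)&\text{if }L<x\le K_1.\end{cases}$$ Say that $\mathcal Y$ satisfies $\spadesuit$ if $K_1<\infty$ and $|\mathcal Y|\ge\min\{\binom{K_1-J+1}{L-J+1},(K_1-J)^2+1\}$. Then $P_1$ is a probability distribution on $\mathcal X$, and the following holds for every symmetric, concave, lower semicontinuous $\phi:\mathcal P(\mathcal X)\to[0,\infty]$. (a) For every $\sigma$-algebra on $\mathcal Y$, $$\sup_{(X,Y):\,P_{\mathrm e}^{(L)}(X\mid Y)\le\varepsilon,\ P_X=Q}\mathfrak h_\phi(X\mid Y)\le\phi(P_1),\qquad(*)$$ the supremum being over all $\mathcal X\times\mathcal Y$-valued random variables $(X,Y)$ with $P_{\mathrm e}^{(L)}(X\mid Y)\le\varepsilon$ and $P_X=Q$. (b) If $\mathcal Y$ is standard Borel, then $(*)$ holds with equality if any one of the following holds: 1) $\varepsilon=P_{\mathrm e}^{(L)}(Q)$; 2) $\mathcal Y$ satisfies $\spadesuit$ and $0<\varepsilon<P_{\mathrm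 e}^{(L)}(Q)$; 3) $\mathcal Y$ satisfies $\spadesuit$ and $\operatorname{supp}(Q)$ is finite; 4) $J=L$ and $|\mathcal Y|=\aleph_0$. (c) If $|\mathcal Y|\ge\mathfrak c$ (the cardinality of $\mathbb R$), then there is a $\sigma$-algebra on $\mathcal Y$, independent of $\phi$, for which $(*)$ holds with equality. (d) For every $\sigma$-algebra on $\mathcal Y$, if $P_X=Q$ and for every $x\in\mathcal X$ $$P_{X|Y}^\downarrow(x)=P_1(x)\quad\text{a.s.},\qquad(**)$$ then $P_{\mathrm e}^{(L)}(X\mid Y)\le\varepsilon$, equality holds in $(*)$, and $(X,Y)$ achieves the supremum in $(*)$. If moreover the concavity of $\phi$ is strict and $\phi(P_1)<\infty$, then a pair $(X,Y)$ with $P_X=Q$ satisfies $P_{\mathrm e}^{(L)}(X\mid Y)\le\varepsilon$ and achieves equality in $(*)$, i.e. $\mathfrak h_\phi(X\mid Y)=\sup=\phi(P_1)$, if and only if $(**)$ holds for every $x\in\mathcal X$. -/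

import Mathlib

open MeasureTheory ProbabilityTheory Filter
open scoped ENNReal Topology

universe u v

noncomputable section

namespace Fano

/- The alphabet `{1, 2, 3, …}` is modelled by `ℕ`, the symbol `x ≥ 1` being the natural number
`x - 1`.  A probability distribution on the alphabet is a `PMF ℕ`. -/

/-- The `n`-th entry (counting from `0`) of the decreasing rearrangement of `P`: the least level
`t` such that at most `n` symbols have mass exceeding `t`. -/
def rearrFun (P : PMF ℕ) (n : ℕ) : ℝ≥0∞ :=
  sInf {t : ℝ≥0∞ | {x | t < P x}.encard ≤ n}

theorem lt_rearrFun_iff (P : PMF ℕ) (n : ℕ) (t : ℝ≥0∞) :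
    t < rearrFun P n ↔ (n : ℕ∞) < {x | t < P x}.encard := by
  constructor
  · intro h
    by_contra hn
    exact absurd (sInf_le (show t ∈ {t : ℝ≥0∞ | {x | t < P x}.encard ≤ n} from not_lt.1 hn))
      (not_le.2 h)
  · intro h
    have h' : ((n + 1 : ℕ) : ℕ∞) ≤ {x | t < P x}.encard := by
      rw [Nat.cast_add, Nat.cast_one]
      exact Order.add_one_le_of_lt h
    obtain ⟨s, hs, hcard⟩ := Set.exists_subset_encard_eq h'
    have hfin : s.Finite := Set.finite_of_encard_eq_coe hcard
    have hne : s.Nonempty := by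
      rw [Set.nonempty_iff_ne_empty]
      rintro rfl
      simp at hcard
      exact absurd hcard.symm (by positivity)
    obtain ⟨m, hm, hmin⟩ := Set.exists_min_image s P hfin hne
    refine lt_of_lt_of_le (hs hm) (le_sInf fun r hr => ?_)
    by_contra hlt
    have hsub : s ⊆ {x | r < P x} := fun x hx => lt_of_lt_of_le (not_le.1 hlt) (hmin x hx)
    have h1 := (Set.encard_le_encard hsub).trans hr
    rw [hcard] at h1
    have : n + 1 ≤ n := by exact_mod_cast h1
    omega

theorem rearrFun_le_one (P : PMF ℕ) (n : ℕ) : rearrFun P n ≤ 1 := by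
  refine sInf_le ?_
  have : {x | 1 < P x} = ∅ := by
    ext x
    simp [P.coe_le_one x]
  simp [this]

theorem encard_iio (k : ℕ∞) : {n : ℕ | (n : ℕ∞) < k}.encard = k := by
  induction k using ENat.recTopCoe with
  | top => simp
  | coe k =>
    have : {n : ℕ | (n : ℕ∞) < k} = (Finset.range k : Set ℕ) := by
      ext n
      simp
    rw [this, Set.encard_coe_eq_coe_finsetCard, Finset.card_range]

theorem tsum_rearrFun (P : PMF ℕ) : ∑' n, rearrFun P n = 1 := by
  have key : ∀ f : ℕ → ℝ≥0∞, (∀ n, f n ≤ 1) → ∑' n, f n =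
      ∫⁻ t in Set.Ioi (0 : ℝ), Measure.count {n | ENNReal.ofReal t < f n} := by
    intro f hf
    have hfin : ∀ n, f n ≠ ∞ := fun n => ((hf n).trans_lt ENNReal.one_lt_top).ne
    have h := lintegral_eq_lintegral_meas_lt (Measure.count : Measure ℕ)
      (f := fun n => (f n).toReal) (Eventually.of_forall fun n => ENNReal.toReal_nonneg)
      (measurable_of_countable _).aemeasurable
    rw [lintegral_count] at h
    simp only [ENNReal.ofReal_toReal (hfin _)] at h
    rw [h]
    refine setLIntegral_congr_fun measurableSet_Ioi fun t ht => ?_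
    congr 1
    ext n
    exact (ENNReal.ofReal_lt_iff_lt_toReal (le_of_lt ht) (hfin n)).symm
  rw [key _ (rearrFun_le_one P), ← P.tsum_coe, key _ P.coe_le_one]
  refine lintegral_congr fun t => ?_
  simp only [lt_rearrFun_iff]
  rw [Measure.count_apply (MeasurableSet.of_discrete), Measure.count_apply
    (MeasurableSet.of_discrete), encard_iio]

/-- The decreasing rearrangement `P↓` of `P`. -/
def rearr (P : PMF ℕ) : PMF ℕ :=
  ⟨rearrFun P, by rw [← tsum_rearrFun P]; exact ENNReal.summable.hasSum⟩

/-! ### Information measures -/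

/-- `φ(P) = φ(P↓)` for all `P`. -/
def IsSymmetric (φ : PMF ℕ → ℝ≥0∞) : Prop :=
  ∀ P, φ P = φ (rearr P)

/-- Sequential lower semicontinuity for pointwise convergence. -/
def IsLSC (φ : PMF ℕ → ℝ≥0∞) : Prop :=
  ∀ (P : PMF ℕ) (Pn : ℕ → PMF ℕ), (∀ x, Tendsto (fun n => Pn n x) atTop (𝓝 (P x))) →
    φ P ≤ liminf (fun n => φ (Pn n)) atTop

/-- Concavity: `a φ(P) + b φ(P') ≤ φ(a P + b P')` for weights `a + b = 1`. -/
def IsConcave (φ : PMF ℕ → ℝ≥0∞) : Prop :=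
  ∀ (P P' R : PMF ℕ) (a b : ℝ≥0∞), a + b = 1 → (∀ x, R x = a * P x + b * P' x) →
    a * φ P + b * φ P' ≤ φ R

/-- Strictness of the concavity: the inequality is strict if `P ≠ P'`, both weights are positive,
and `φ(P)`, `φ(P')` are finite (it cannot be strict otherwise). -/
def IsStrict (φ : PMF ℕ → ℝ≥0∞) : Prop :=
  ∀ (P P' R : PMF ℕ) (a b : ℝ≥0∞), a + b = 1 → a ≠ 0 → b ≠ 0 → P ≠ P' → φ P ≠ ∞ → φ P' ≠ ∞ →
    (∀ x, R x = a * P x + b * P' x) → a * φ P + b * φ P' < φ R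

/-! ### Random variables -/

section RandomVariables

variable {Ω : Type v} {𝒴 : Type u} [MeasurableSpace Ω] [MeasurableSpace 𝒴]

/-- The regular conditional distribution of `X` given `Y = y`. -/
def condPMF (X : Ω → ℕ) (Y : Ω → 𝒴) (μ : Measure Ω) [IsFiniteMeasure μ] (y : 𝒴) : PMF ℕ :=
  (condDistrib X Y μ y).toPMF

/-- `h_φ(X | Y) = E[φ(P_{X|Y})]`. -/
def condInfo (φ : PMF ℕ → ℝ≥0∞) (X : Ω → ℕ) (Y : Ω → 𝒴) (μ : Measure Ω) [IsFiniteMeasure μ] :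
    ℝ≥0∞ :=
  ∫⁻ ω, φ (condPMF X Y μ (Y ω)) ∂μ

/-- `f` is a (measurable) list decoder with nonempty lists of size at most `L`. -/
def IsListDecoder (L : ℕ) (f : 𝒴 → Finset ℕ) : Prop :=
  (∀ y, 1 ≤ (f y).card ∧ (f y).card ≤ L) ∧ ∀ x, MeasurableSet {y | x ∈ f y}

/-- The minimum average probability of list decoding error with list size `L`. -/
def listError (L : ℕ) (X : Ω → ℕ) (Y : Ω → 𝒴) (μ : Measure Ω) : ℝ≥0∞ :=
  ⨅ (f : 𝒴 → Finset ℕ) (_ : IsListDecoder L f), μ {ω | X ω ∉ f (Y ω)}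

/-- `(X, Y)` is a pair of random variables with `P_X = Q` and list error at most `ε`. -/
def Feasible (Q : PMF ℕ) (L : ℕ) (ε : ℝ) (X : Ω → ℕ) (Y : Ω → 𝒴) (μ : Measure Ω) : Prop :=
  Measurable X ∧ Measurable Y ∧ μ.map X = Q.toMeasure ∧ listError L X Y μ ≤ ENNReal.ofReal ε

end RandomVariables

/-- The supremum of `h_φ(X | Y)` over all feasible pairs of random variables with `Y` valued in
the measurable space `𝒴`. -/
def supInfo (φ : PMF ℕ → ℝ≥0∞) (Q : PMF ℕ) (L : ℕ) (ε : ℝ) (𝒴 : Type u) [MeasurableSpace 𝒴] :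
    ℝ≥0∞ :=
  sSup {h | ∃ (Ω : Type u) (_ : MeasurableSpace Ω) (μ : Measure Ω) (_ : IsProbabilityMeasure μ)
    (X : Ω → ℕ) (Y : Ω → 𝒴), Feasible Q L ε X Y μ ∧ h = condInfo φ X Y μ}

/-! ### The type-1 Fano distribution -/

section Type1

variable (Q : PMF ℕ) (L : ℕ) (ε : ℝ)

/-- `Q↓(j)` as a real number, for a symbol `j ≥ 1`. -/
def q (j : ℕ) : ℝ := (rearr Q (j - 1)).toReal

/-- The list error probability `1 - ∑_{x=1}^{L} Q↓(x)` without side information. -/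
def marginalError : ℝ := 1 - ∑ x ∈ Finset.Icc 1 L, q Q x

/-- The weight `𝒱(j)`, `j ≥ 1`. -/
def V (j : ℕ) : ℝ :=
  if j ≤ L then ((1 - ε) - ∑ x ∈ Finset.Ico 1 j, q Q x) / ((L : ℝ) - j + 1) else 1

/-- The weight `𝒲(k)`, `L ≤ k ≤ ∞`. -/
def W : ℕ∞ → ℝ
  | ⊤ => 0
  | (k : ℕ) => if k = L then -1 else ((∑ x ∈ Finset.Icc 1 k, q Q x) - (1 - ε)) / ((k : ℝ) - L)

/-- `J = min {j ≥ 1 | Q↓(j) < 𝒱(j)}`. -/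
def J : ℕ := sInf {j : ℕ | 1 ≤ j ∧ q Q j < V Q L ε j}

/-- `K₁ = sup {L ≤ k < ∞ | 𝒲(k) < Q↓(k)}`, possibly infinite. -/
def K : ℕ∞ := sSup {k : ℕ∞ | ∃ n : ℕ, k = n ∧ L ≤ n ∧ W Q L ε n < q Q n}

/-- The mass of the type-1 Fano distribution at a symbol `x ≥ 1`. -/
def fanoMass (x : ℕ) : ℝ :=
  if x < J Q L ε ∨ K Q L ε < x then q Q x
  else if x ≤ L then V Q L ε (J Q L ε)
  else W Q L ε (K Q L ε)

/-- `P` is the type-1 Fano distribution built from `(Q, L, ε)`. -/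
def IsFanoType1 (P : PMF ℕ) : Prop :=
  ∀ x : ℕ, 1 ≤ x → (P (x - 1)).toReal = fanoMass Q L ε x

/-- The admissible range of `ε`: `1 - ∑_{x=1}^{#(𝒴) L} Q↓(x) ≤ ε ≤ 1 - ∑_{x=1}^{L} Q↓(x)`. -/
def InRange (𝒴 : Type u) : Prop :=
  1 - (∑' i : ℕ, if ((i + 1 : ℕ) : ℕ∞) ≤ ENat.card 𝒴 * L then q Q (i + 1) else 0) ≤ ε ∧
    ε ≤ marginalError Q L

/-- `K₁` is finite and `|𝒴| ≥ min {binom (K₁ - J + 1) (L - J + 1), (K₁ - J)² + 1}`.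
Here `J ≤ L + 1` and `L ≤ K₁`; if `K₁ < J` then `K₁ = L = J - 1` and the minimum is `1`, so the
truncated subtraction is harmless. -/
def Spade (𝒴 : Type u) : Prop :=
  ∃ k : ℕ, K Q L ε = k ∧
    ((min ((k + 1 - J Q L ε).choose (L + 1 - J Q L ε)) ((k - J Q L ε) ^ 2 + 1) : ℕ) :
      Cardinal.{u}) ≤ Cardinal.mk 𝒴

end Type1

/-- `P_{X|Y}↓(x) = P₁(x)` almost surely, for every symbol `x`. -/
def IsSharp {Ω : Type v} {𝒴 : Type u} [MeasurableSpace Ω] [MeasurableSpace 𝒴] (P₁ : PMF ℕ)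
    (X : Ω → ℕ) (Y : Ω → 𝒴) (μ : Measure Ω) [IsFiniteMeasure μ] : Prop :=
  ∀ x, ∀ᵐ ω ∂μ, rearr (condPMF X Y μ (Y ω)) x = P₁ x

end Fano

end

noncomputable section

namespace Fano

/-! ### The decreasing rearrangement -/

/-! Upper bound. Let R be the mean of the rearranged posteriors (`meanRearr`). A list of k symbols
catches at most the k largest posterior masses; hence R majorizes Q, and its L largest masses add up
to at least 1 - ε. The Fano distribution P₁ is the least nonincreasing distribution with these
properties for majorization (`Shape.sum_le`): its partial sums agree with those of Q↓ up to J - 1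
and from K₁ on, and are affine from J - 1 to L and from L to K₁, while those of R are concave.
Jensen's inequality (`lintegral_le_bary`) bounds h_φ by φ(R), and Schur concavity (`le_of_majorize`)
bounds φ(R) by φ(P₁). Both are proved in a finite or countable setting and extended by lower
semicontinuity. Under strict concavity, equality forces R = P₁ (`eq_of_majorize`) and then almost
surely constant rearranged posteriors (`ae_eq_bary`).

Attainment. It suffices to write Q as a mixture of arrangements of P₁ indexed by 𝒴
(`IsExtremal.le_supInfo`). If ε is the marginal error, then P₁ = Q↓ and a constant Y works.
Otherwise an arrangement is fixed by the L - J + 1 ranks between J and K₁ that receive v = 𝒱(J), the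
others there receiving w = 𝒲(K₁). Rank x must receive v with probability (Q↓(x) - w) / (v - w), and
these probabilities add up to L - J + 1. Systematic sampling draws a set of exactly this size with
these inclusion probabilities (`Shape.exists_mixture`). It takes countably many values, and at most
K₁ - J + 1 of them if K₁ is finite, which is below both terms of the minimum in ♠. -/

theorem rearr_antitone (P : PMF ℕ) : Antitone (rearr P) := by
  intro m n hmn
  refine le_of_forall_lt fun t ht => ?_
  have h := (lt_rearrFun_iff P n t).1 ht
  exact (lt_rearrFun_iff P m t).2 (lt_of_le_of_lt (by exact_mod_cast hmn) h)

theorem rearr_congr {P P' : PMF ℕ}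
    (h : ∀ t : ℝ≥0∞, {x | t < P x}.encard = {x | t < P' x}.encard) : rearr P = rearr P' := by
  ext n
  change rearrFun P n = rearrFun P' n
  simp only [rearrFun, h]

/-- The superlevel sets of an antitone mass function are initial segments, so such a set has more
than n elements exactly when it contains n. -/
theorem rearr_eq_self {P : PMF ℕ} (hP : Antitone P) : rearr P = P := by
  ext n
  have key : ∀ t : ℝ≥0∞, t < rearr P n ↔ t < P n := by
    intro t
    refine (lt_rearrFun_iff P n t).trans ⟨fun h => ?_, fun h => ?_⟩
    · by_contra hn
      have hsub : {x | t < P x} ⊆ {x : ℕ | (x : ℕ∞) < n} := by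
        intro x hx
        by_contra hxn
        have : n ≤ x := by simpa using hxn
        exact hn (lt_of_lt_of_le hx (hP this))
      have := Set.encard_le_encard hsub
      rw [encard_iio] at this
      exact absurd h (not_lt.2 this)
    · have hsub : {x : ℕ | (x : ℕ∞) < (n + 1 : ℕ)} ⊆ {x | t < P x} := by
        intro x hx
        have : x < n + 1 := by exact_mod_cast hx
        exact lt_of_lt_of_le h (hP (by omega))
      have := Set.encard_le_encard hsub
      rw [encard_iio] at this
      exact lt_of_lt_of_le (by exact_mod_cast Nat.lt_succ_self n) this
  exact le_antisymm (le_of_forall_lt fun t ht => (key t).1 ht)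
    (le_of_forall_lt fun t ht => (key t).2 ht)

/-- The distribution with mass function `f`. -/
def mkPMF (f : ℕ → ℝ≥0∞) (h : ∑' x, f x = 1) : PMF ℕ :=
  ⟨f, h ▸ ENNReal.summable.hasSum⟩

@[simp] theorem mkPMF_apply (f : ℕ → ℝ≥0∞) (h : ∑' x, f x = 1) (x : ℕ) : mkPMF f h x = f x := rfl

/-- The distribution `P ∘ σ` for a permutation `σ`. -/
def permute (σ : Equiv.Perm ℕ) (P : PMF ℕ) : PMF ℕ :=
  mkPMF (fun x => P (σ x)) (by rw [σ.tsum_eq (fun x => P x)]; exact P.tsum_coe)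

theorem rearr_permute (σ : Equiv.Perm ℕ) (P : PMF ℕ) : rearr (permute σ P) = rearr P := by
  refine rearr_congr fun t => ?_
  have : {x | t < P x} = σ '' {x | t < permute σ P x} := by
    ext x
    constructor
    · intro h
      exact ⟨σ.symm x, by simpa [permute] using h, by simp⟩
    · rintro ⟨y, hy, rfl⟩
      exact hy
  rw [this, σ.injective.injOn.encard_image]

/-- The symbols that precede `x` when the symbols are sorted by decreasing mass under `P`. -/
def precede (P : PMF ℕ) (x : ℕ) : Set ℕ := {y | P x < P y ∨ P y = P x ∧ y < x}

/-- The number of symbols that precede `x`. -/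
def rank (P : PMF ℕ) (x : ℕ) : ℕ := (precede P x).ncard

theorem finite_le_apply (P : PMF ℕ) {t : ℝ≥0∞} (ht : t ≠ 0) : {x | t ≤ P x}.Finite :=
  ENNReal.finite_const_le_of_tsum_ne_top (by rw [P.tsum_coe]; exact ENNReal.one_ne_top) ht

theorem precede_subset (P : PMF ℕ) (x : ℕ) : precede P x ⊆ {y | P x ≤ P y} := by
  rintro y (h | h)
  · exact h.le
  · exact h.1.ge

theorem precede_finite {P : PMF ℕ} {x : ℕ} (hx : P x ≠ 0) : (precede P x).Finite :=
  (finite_le_apply P hx).subset (precede_subset P x)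

/-- At a symbol of mass zero `precede` may be infinite, and `ncard` then returns 0; ranks are
meaningful on the support only. -/
theorem coe_rank {P : PMF ℕ} {x : ℕ} (hx : P x ≠ 0) :
    (rank P x : ℕ∞) = (precede P x).encard :=
  (precede_finite hx).cast_ncard_eq

/-- Precedence is transitive and irreflexive, so the predecessors of `y` are among those of `x`, and
`y` itself is not one of them. -/
theorem rank_lt_of_mem_precede {P : PMF ℕ} {x y : ℕ} (hx : P x ≠ 0) (h : y ∈ precede P x) :
    rank P y < rank P x := by
  refine Set.ncard_lt_ncard ⟨?_, fun hsub => ?_⟩ (precede_finite hx)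
  · rintro z (hz | hz) <;> rcases h with h | h
    · exact Or.inl (h.trans hz)
    · exact Or.inl (h.1 ▸ hz)
    · exact Or.inl (hz.1 ▸ h)
    · exact Or.inr ⟨hz.1.trans h.1, hz.2.trans h.2⟩
  · rcases hsub h with h | h <;> simp at h

theorem rank_injOn (P : PMF ℕ) : Set.InjOn (rank P) {x | P x ≠ 0} := by
  intro x hx y hy hxy
  by_contra hne
  have : x ∈ precede P y ∨ y ∈ precede P x := by
    rcases lt_trichotomy (P x) (P y) with h | h | h
    · exact Or.inr (Or.inl h)
    · rcases lt_or_gt_of_ne hne with h' | h'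
      · exact Or.inl (Or.inr ⟨h, h'⟩)
      · exact Or.inr (Or.inr ⟨h.symm, h'⟩)
    · exact Or.inl (Or.inl h)
  rcases this with h | h
  · exact (rank_lt_of_mem_precede hy h).ne hxy
  · exact (rank_lt_of_mem_precede hx h).ne hxy.symm

/-- All symbols of larger mass precede `x`, while `x` and its predecessors all have mass at least `P
x`. -/
theorem rearr_rank {P : PMF ℕ} {x : ℕ} (hx : P x ≠ 0) : rearr P (rank P x) = P x := by
  refine le_antisymm (not_lt.1 fun h => ?_) (le_of_forall_lt fun t ht => ?_)
  · have h := (lt_rearrFun_iff P _ _).1 h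
    rw [coe_rank hx] at h
    exact absurd h (not_lt.2 (Set.encard_le_encard fun y hy => Or.inl hy))
  · refine (lt_rearrFun_iff P _ _).2 ?_
    have hsub : insert x (precede P x) ⊆ {y | t < P y} := by
      rintro y (rfl | hy)
      · exact ht
      · exact lt_of_lt_of_le ht (precede_subset P x hy)
    have h := Set.encard_le_encard hsub
    have hnot : x ∉ precede P x := by
      rintro (h | h) <;> simp at h
    rw [Set.encard_insert_of_notMem hnot, ← coe_rank hx] at h
    exact lt_of_lt_of_le (by exact_mod_cast Nat.lt_succ_self _) h

theorem tsum_support_eq_one (P : PMF ℕ) : ∑' x : {x | P x ≠ 0}, P x = 1 := by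
  rw [← P.tsum_coe]
  exact tsum_subtype_eq_of_support_subset (f := fun x => P x) (fun x hx => hx)

/-- The ranks of the support already carry total rearranged mass 1, so `rearr P` vanishes at every
other index. -/
theorem exists_rank_eq {P : PMF ℕ} {n : ℕ} (hn : rearr P n ≠ 0) : ∃ x, P x ≠ 0 ∧ rank P x = n := by
  by_contra! hcon
  have h1 : ∑' y : (rank P '' {x | P x ≠ 0}), rearr P y = 1 := by
    rw [tsum_image (fun y => rearr P y) (rank_injOn P), ← tsum_support_eq_one P]
    exact tsum_congr fun x => rearr_rank x.2
  have h2 := (rearr P).tsum_coe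
  have h3 := ENNReal.summable.tsum_add_tsum_compl (f := fun y => rearr P y)
    (s := rank P '' {x | P x ≠ 0}) ENNReal.summable
  rw [h1, h2] at h3
  have h4 : ∑' y : ((rank P '' {x | P x ≠ 0})ᶜ : Set ℕ), rearr P y = 0 := by
    have : (1 : ℝ≥0∞) + ∑' y : ((rank P '' {x | P x ≠ 0})ᶜ : Set ℕ), rearr P y = 1 + 0 := by
      simpa using h3
    exact (ENNReal.add_right_inj ENNReal.one_ne_top).1 this
  rw [ENNReal.tsum_eq_zero] at h4
  refine hn (h4 ⟨n, ?_⟩)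
  rintro ⟨x, hx, hxn⟩
  exact hcon x hx hxn

/-- Split off the largest index of `s`: it is at least the number of the remaining ones. -/
theorem sum_le_sum_range_card {f : ℕ → ℝ≥0∞} (hf : Antitone f) (s : Finset ℕ) :
    ∑ i ∈ s, f i ≤ ∑ i ∈ Finset.range s.card, f i := by
  induction s using Finset.induction_on_max with
  | empty => simp
  | insert a s ha ih =>
    have hnot : a ∉ s := fun h => lt_irrefl a (ha a h)
    rw [Finset.sum_insert hnot, Finset.card_insert_of_notMem hnot, Finset.sum_range_succ, add_comm]
    refine add_le_add ih (hf ?_)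
    have : s ⊆ Finset.range a := fun x hx => Finset.mem_range.2 (ha x hx)
    simpa using Finset.card_le_card this

/-- The mass of `s` is at most the sum of the `|s|` largest masses. -/
theorem sum_le_sum_rearr (P : PMF ℕ) (s : Finset ℕ) :
    ∑ x ∈ s, P x ≤ ∑ i ∈ Finset.range s.card, rearr P i := by
  classical
  have hinj : Set.InjOn (rank P) (s.filter fun x => P x ≠ 0) :=
    (rank_injOn P).mono fun x hx => by simpa using (Finset.mem_filter.1 hx).2
  calc ∑ x ∈ s, P x = ∑ x ∈ s.filter (fun x => P x ≠ 0), P x := by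
        rw [Finset.sum_filter_ne_zero]
    _ = ∑ x ∈ s.filter (fun x => P x ≠ 0), rearr P (rank P x) :=
        Finset.sum_congr rfl fun x hx => (rearr_rank (Finset.mem_filter.1 hx).2).symm
    _ = ∑ i ∈ (s.filter fun x => P x ≠ 0).image (rank P), rearr P i :=
        (Finset.sum_image hinj).symm
    _ ≤ ∑ i ∈ Finset.range ((s.filter fun x => P x ≠ 0).image (rank P)).card, rearr P i :=
        sum_le_sum_range_card (rearr_antitone P) _
    _ ≤ ∑ i ∈ Finset.range s.card, rearr P i := by
        refine Finset.sum_le_sum_of_subset (Finset.range_subset_range.2 ?_)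
        exact Finset.card_image_le.trans (Finset.card_filter_le _ _)

/-- The symbols of positive mass whose rank is less than `L`. -/
def topSet (P : PMF ℕ) (L : ℕ) : Set ℕ := {x | P x ≠ 0 ∧ (precede P x).encard < L}

theorem topSet_eq (P : PMF ℕ) (L : ℕ) : topSet P L = {x | P x ≠ 0 ∧ rank P x < L} := by
  ext x
  refine and_congr_right fun hx => ?_
  rw [← coe_rank hx]
  exact Nat.cast_lt

theorem topSet_finite (P : PMF ℕ) (L : ℕ) : (topSet P L).Finite := by
  rw [topSet_eq]
  refine Set.Finite.of_finite_image ((Set.finite_lt_nat L).subset ?_)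
    ((rank_injOn P).mono fun x hx => hx.1)
  rintro _ ⟨x, hx, rfl⟩
  exact hx.2

/-- The list of the `L` most likely symbols. -/
def topFinset (P : PMF ℕ) (L : ℕ) : Finset ℕ := (topSet_finite P L).toFinset

theorem mem_topFinset {P : PMF ℕ} {L x : ℕ} : x ∈ topFinset P L ↔ P x ≠ 0 ∧ rank P x < L := by
  simp [topFinset, topSet_eq]

theorem card_topFinset_le (P : PMF ℕ) (L : ℕ) : (topFinset P L).card ≤ L := by
  rw [← Finset.card_range L]
  refine Finset.card_le_card_of_injOn (rank P) (fun x hx => ?_) fun x hx y hy h => ?_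
  · simpa using (mem_topFinset.1 hx).2
  · exact rank_injOn P (mem_topFinset.1 hx).1 (mem_topFinset.1 hy).1 h

/-- If the support has fewer than `L` symbols, the ranks do not fill `range L`; the missed indices
carry no rearranged mass. -/
theorem sum_topFinset (P : PMF ℕ) (L : ℕ) :
    ∑ x ∈ topFinset P L, P x = ∑ i ∈ Finset.range L, rearr P i := by
  classical
  have h1 : ∑ x ∈ topFinset P L, P x = ∑ i ∈ (topFinset P L).image (rank P), rearr P i := by
    rw [Finset.sum_image fun x hx y hy h =>
      rank_injOn P (mem_topFinset.1 hx).1 (mem_topFinset.1 hy).1 h]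
    exact Finset.sum_congr rfl fun x hx => (rearr_rank (mem_topFinset.1 hx).1).symm
  rw [h1]
  refine Finset.sum_subset (fun i hi => ?_) fun i hi hni => ?_
  · obtain ⟨x, hx, rfl⟩ := Finset.mem_image.1 hi
    exact Finset.mem_range.2 (mem_topFinset.1 hx).2
  · by_contra h
    obtain ⟨x, hx, rfl⟩ := exists_rank_eq h
    exact hni (Finset.mem_image_of_mem _ (mem_topFinset.2 ⟨hx, Finset.mem_range.1 hi⟩))

theorem rearr_zero_ne_zero (P : PMF ℕ) : rearr P 0 ≠ 0 := by
  intro h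
  have h1 := (rearr P).tsum_coe
  have h2 : ∀ n, rearr P n = 0 := fun n =>
    le_antisymm (h ▸ rearr_antitone P (Nat.zero_le n)) bot_le
  simp [h2] at h1

theorem one_le_card_topFinset (P : PMF ℕ) {L : ℕ} (hL : 1 ≤ L) : 1 ≤ (topFinset P L).card := by
  obtain ⟨x, hx, hr⟩ := exists_rank_eq (rearr_zero_ne_zero P)
  exact Finset.card_pos.2 ⟨x, mem_topFinset.2 ⟨hx, by omega⟩⟩

/-! ### Schur concavity -/

theorem apply_ne_top (P : PMF ℕ) (x : ℕ) : P x ≠ ∞ := P.apply_ne_top x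

theorem eq_of_forall_le {P R : PMF ℕ} (h : ∀ x, P x ≤ R x) : P = R := by
  ext x
  by_contra hne
  have hlt := lt_of_le_of_ne (h x) hne
  have := ENNReal.tsum_lt_tsum (i := x) (f := fun x => P x) (g := fun x => R x)
    (by rw [P.tsum_coe]; exact ENNReal.one_ne_top) h hlt
  rw [P.tsum_coe, R.tsum_coe] at this
  exact lt_irrefl _ this

/-- The convex combination `a P + b P'`. -/
def mix (a b : ℝ≥0∞) (hab : a + b = 1) (P P' : PMF ℕ) : PMF ℕ :=
  mkPMF (fun x => a * P x + b * P' x) (by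
    rw [ENNReal.tsum_add, ENNReal.tsum_mul_left, ENNReal.tsum_mul_left, P.tsum_coe, P'.tsum_coe,
      mul_one, mul_one, hab])

theorem mix_apply (a b : ℝ≥0∞) (hab : a + b = 1) (P P' : PMF ℕ) (x : ℕ) :
    mix a b hab P P' x = a * P x + b * P' x := rfl

theorem IsSymmetric.permute {φ : PMF ℕ → ℝ≥0∞} (hφ : IsSymmetric φ) (σ : Equiv.Perm ℕ)
    (P : PMF ℕ) : φ (permute σ P) = φ P := by
  rw [hφ, rearr_permute, ← hφ]

/-- Moving mass `δ` from `i` to `j` does not decrease `φ`, as long as `δ ≤ P i - P j`. -/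
theorem exists_transfer {φ : PMF ℕ → ℝ≥0∞} (hs : IsSymmetric φ) (hc : IsConcave φ) (P : PMF ℕ)
    {i j : ℕ} {δ : ℝ} (hδ : 0 < δ) (hle : (P j).toReal + δ ≤ (P i).toReal) :
    ∃ P' : PMF ℕ, φ P ≤ φ P' ∧ (P' i).toReal = (P i).toReal - δ ∧
      (P' j).toReal = (P j).toReal + δ ∧ ∀ x, x ≠ i → x ≠ j → P' x = P x := by
  have hd : 0 < (P i).toReal - (P j).toReal := by linarith
  -- Mixing `P` with its image under the swap of `i` and `j`, with weight `l` on the latter, moves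
  -- mass `l * (P i - P j)`, which is to equal `δ`. By symmetry the swap does not change `φ`.
  set l : ℝ := δ / ((P i).toReal - (P j).toReal) with hl
  have hl0 : 0 ≤ l := by positivity
  have hl1 : l ≤ 1 := by rw [hl, div_le_one hd]; linarith
  have hlm : l * ((P i).toReal - (P j).toReal) = δ := by rw [hl]; field_simp
  have hab : ENNReal.ofReal (1 - l) + ENNReal.ofReal l = 1 := by
    rw [← ENNReal.ofReal_add (by linarith) hl0]; simp
  have hreal : ∀ x y : ℝ≥0∞, x ≠ ∞ → y ≠ ∞ →
      (ENNReal.ofReal (1 - l) * x + ENNReal.ofReal l * y).toReal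
        = (1 - l) * x.toReal + l * y.toReal := by
    intro x y hx hy
    rw [ENNReal.toReal_add (ENNReal.mul_ne_top ENNReal.ofReal_ne_top hx)
      (ENNReal.mul_ne_top ENNReal.ofReal_ne_top hy), ENNReal.toReal_mul, ENNReal.toReal_mul,
      ENNReal.toReal_ofReal (by linarith), ENNReal.toReal_ofReal hl0]
  refine ⟨mix _ _ hab P (permute (Equiv.swap i j) P), ?_, ?_, ?_, ?_⟩
  · have h := hc P (permute (Equiv.swap i j) P) _ _ _ hab
      (mix_apply _ _ hab P (permute (Equiv.swap i j) P))
    rwa [hs.permute, ← add_mul, hab, one_mul] at h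
  · rw [mix_apply, hreal _ _ (apply_ne_top _ _) (apply_ne_top _ _)]
    simp only [permute, mkPMF_apply, Equiv.swap_apply_left]
    linarith
  · rw [mix_apply, hreal _ _ (apply_ne_top _ _) (apply_ne_top _ _)]
    simp only [permute, mkPMF_apply, Equiv.swap_apply_right]
    linarith
  · intro x hxi hxj
    rw [mix_apply]
    simp only [permute, mkPMF_apply, Equiv.swap_apply_of_ne_of_ne hxi hxj]
    rw [← add_mul, hab, one_mul]

/-- Schur concavity for distributions that differ at finitely many symbols. -/
theorem le_of_majorize_of_finite {φ : PMF ℕ → ℝ≥0∞} (hs : IsSymmetric φ) (hc : IsConcave φ)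
    {P : PMF ℕ} (hP : Antitone P) (R : PMF ℕ)
    (hmaj : ∀ k, ∑ i ∈ Finset.range k, (P i).toReal ≤ ∑ i ∈ Finset.range k, (R i).toReal)
    (hfin : {x | R x ≠ P x}.Finite) : φ R ≤ φ P := by
  classical
  -- Each transfer makes `R` agree with `P` at one more symbol.
  induction hn : {x | R x ≠ P x}.ncard using Nat.strong_induction_on generalizing R with
  | _ n ih =>
  by_cases hall : ∀ x, P x ≤ R x
  · rw [eq_of_forall_le hall]
  push Not at hall
  -- `j` is the first symbol where `R` falls below `P`; majorization at `j + 1` then forces an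
  -- excess of `R` at some earlier `i`.
  set j := Nat.find hall with hj
  have hj1 : (R j).toReal < (P j).toReal :=
    ENNReal.toReal_strict_mono (apply_ne_top _ _) (Nat.find_spec hall)
  have hj2 : ∀ x < j, (P x).toReal ≤ (R x).toReal := fun x hx =>
    ENNReal.toReal_mono (apply_ne_top _ _) (not_lt.1 (Nat.find_min hall hx))
  obtain ⟨i, hij, hi⟩ : ∃ i < j, (P i).toReal < (R i).toReal := by
    by_contra! hcon
    have h := hmaj (j + 1)
    rw [Finset.sum_range_succ, Finset.sum_range_succ] at h
    have : ∑ i ∈ Finset.range j, (R i).toReal ≤ ∑ i ∈ Finset.range j, (P i).toReal :=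
      Finset.sum_le_sum fun x hx => hcon x (Finset.mem_range.1 hx)
    linarith
  -- The largest transfer from `i` to `j` that overshoots neither target: afterwards `R'` equals `P`
  -- at `i` or at `j`.
  set δ := min ((R i).toReal - (P i).toReal) ((P j).toReal - (R j).toReal) with hδ
  have hδ0 : 0 < δ := lt_min (by linarith) (by linarith)
  have hδ1 : δ ≤ (R i).toReal - (P i).toReal := min_le_left _ _
  have hδ2 : δ ≤ (P j).toReal - (R j).toReal := min_le_right _ _
  have hPij : (P j).toReal ≤ (P i).toReal := ENNReal.toReal_mono (apply_ne_top _ _) (hP hij.le)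
  obtain ⟨R', hR', hi', hj', hx'⟩ := exists_transfer hs hc R (i := i) (j := j) hδ0 (by linarith)
  have hsub : {x | R' x ≠ P x} ⊂ {x | R x ≠ P x} := by
    have hsub' : {x | R' x ≠ P x} ⊆ {x | R x ≠ P x} := by
      intro x hx
      by_cases hxi : x = i
      · subst hxi; intro h; rw [h] at hi; exact lt_irrefl _ hi
      by_cases hxj : x = j
      · subst hxj; intro h; rw [h] at hj1; exact lt_irrefl _ hj1
      · simpa [← hx' x hxi hxj] using hx
    refine ⟨hsub', fun hcon => ?_⟩
    rcases min_choice ((R i).toReal - (P i).toReal) ((P j).toReal - (R j).toReal) with h | h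
    · have hmem : i ∈ {x | R x ≠ P x} := fun h => by rw [h] at hi; exact lt_irrefl _ hi
      refine hcon hmem ((ENNReal.toReal_eq_toReal_iff' (apply_ne_top _ _) (apply_ne_top _ _)).1 ?_)
      rw [hi', hδ, h]; ring
    · have hmem : j ∈ {x | R x ≠ P x} := fun h => by rw [h] at hj1; exact lt_irrefl _ hj1
      refine hcon hmem ((ENNReal.toReal_eq_toReal_iff' (apply_ne_top _ _) (apply_ne_top _ _)).1 ?_)
      rw [hj', hδ, h]; ring
  refine hR'.trans (ih _ (hn ▸ Set.ncard_lt_ncard hsub hfin) R' (fun k => ?_)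
    (hfin.subset hsub.1) rfl)
  -- Before `j` the new masses still dominate those of `P` termwise; beyond `j` the sum contains
  -- both `i` and `j` and is unchanged.
  by_cases hk : k ≤ j
  · refine Finset.sum_le_sum fun x hx => ?_
    have hxj : x < j := lt_of_lt_of_le (Finset.mem_range.1 hx) hk
    by_cases hxi : x = i
    · subst hxi; linarith
    · rw [hx' x hxi hxj.ne]; exact hj2 x hxj
  · refine (hmaj k).trans (le_of_eq ?_)
    have hdiff : ∀ x, (R' x).toReal
        = (R x).toReal + ((if x = j then δ else 0) - (if x = i then δ else 0)) := by
      intro x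
      by_cases hxi : x = i
      · subst hxi; simp [hi', hij.ne]; ring
      by_cases hxj : x = j
      · rw [hxj, hj']; simp [hij.ne']
      · simp [hx' x hxi hxj, hxi, hxj]
    simp only [hdiff, Finset.sum_add_distrib, Finset.sum_sub_distrib, Finset.sum_ite_eq',
      Finset.mem_range]
    rw [if_pos (by omega), if_pos (by omega)]
    ring

theorem sum_range_sub_of_monotone {T : ℕ → ℝ≥0∞} (hT : Monotone T) (h0 : T 0 = 0) (k : ℕ) :
    ∑ i ∈ Finset.range k, (T (i + 1) - T i) = T k := by
  induction k with
  | zero => simp [h0]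
  | succ k ih => rw [Finset.sum_range_succ, ih, add_tsub_cancel_of_le (hT (Nat.le_succ k))]

theorem sum_range_le_one (P : PMF ℕ) (k : ℕ) : ∑ i ∈ Finset.range k, P i ≤ 1 :=
  P.tsum_coe ▸ ENNReal.sum_le_tsum _

/-- Schur concavity of symmetric, concave, lower semicontinuous functions. -/
theorem le_of_majorize {φ : PMF ℕ → ℝ≥0∞} (hs : IsSymmetric φ) (hc : IsConcave φ) (hl : IsLSC φ)
    {P : PMF ℕ} (hP : Antitone P) (R : PMF ℕ)
    (hmaj : ∀ k, ∑ i ∈ Finset.range k, P i ≤ ∑ i ∈ Finset.range k, R i) : φ R ≤ φ P := by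
  classical
  set SR : ℕ → ℝ≥0∞ := fun k => ∑ i ∈ Finset.range k, R i with hSR
  set SP : ℕ → ℝ≥0∞ := fun k => ∑ i ∈ Finset.range k, P i with hSP
  have hSRm : Monotone SR := fun a b hab =>
    Finset.sum_le_sum_of_subset (Finset.range_subset_range.2 hab)
  have hSPm : Monotone SP := fun a b hab =>
    Finset.sum_le_sum_of_subset (Finset.range_subset_range.2 hab)
  -- The approximant `f m` follows `R` until its partial sums reach those of `P` at `m`, is zero
  -- from there to `m`, and then follows `P`. It majorizes `P`, differs from it at finitely many
  -- symbols, and tends to `R` pointwise.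
  set T : ℕ → ℕ → ℝ≥0∞ := fun m k => min (SR k) (SP m) with hT
  have hTm : ∀ m, Monotone (T m) := fun m a b hab => min_le_min (hSRm hab) le_rfl
  have hT0 : ∀ m, T m 0 = 0 := fun m => by simp [hT, hSR]
  set f : ℕ → ℕ → ℝ≥0∞ := fun m x => if x < m then T m (x + 1) - T m x else P x with hf
  have hsum : ∀ m k, k ≤ m → ∑ i ∈ Finset.range k, f m i = T m k := by
    intro m k hk
    rw [← sum_range_sub_of_monotone (hTm m) (hT0 m) k]
    refine Finset.sum_congr rfl fun i hi => ?_
    have : i < m := lt_of_lt_of_le (Finset.mem_range.1 hi) hk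
    simp [hf, this]
  have hsum' : ∀ m, ∑ i ∈ Finset.range m, f m i = ∑ i ∈ Finset.range m, P i := by
    intro m
    rw [hsum m m le_rfl]
    exact min_eq_right (hmaj m)
  have htsum : ∀ m, ∑' x, f m x = 1 := by
    intro m
    rw [← ENNReal.summable.sum_add_tsum_nat_add' (f := f m) (k := m), hsum' m, ← P.tsum_coe,
      ← ENNReal.summable.sum_add_tsum_nat_add' (f := fun x => P x) (k := m)]
    congr 1
    exact tsum_congr fun i => by simp [hf]
  have hreal : ∀ (R' : PMF ℕ) k, ∑ i ∈ Finset.range k, (R' i).toReal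
      = (∑ i ∈ Finset.range k, R' i).toReal := fun R' k =>
    (ENNReal.toReal_sum fun i _ => apply_ne_top _ _).symm
  have hfin : ∀ (R' : PMF ℕ) k, ∑ i ∈ Finset.range k, R' i ≠ ∞ := fun R' k =>
    ((sum_range_le_one R' k).trans_lt ENNReal.one_lt_top).ne
  have hstep : ∀ m, φ (mkPMF (f m) (htsum m)) ≤ φ P := by
    intro m
    refine le_of_majorize_of_finite hs hc hP _ (fun k => ?_) ?_
    · rw [hreal, hreal]
      refine ENNReal.toReal_mono (hfin _ _) ?_
      simp only [mkPMF_apply]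
      by_cases hk : k ≤ m
      · rw [hsum m k hk]
        exact le_min (hmaj k) (hSPm hk)
      · push Not at hk
        rw [← Finset.sum_range_add_sum_Ico _ hk.le, ← Finset.sum_range_add_sum_Ico _ hk.le, hsum' m]
        refine le_of_eq ?_
        congr 1
        refine Finset.sum_congr rfl fun i hi => ?_
        have := (Finset.mem_Ico.1 hi).1
        simp [hf, not_lt.2 this]
    · refine (Set.finite_lt_nat m).subset fun x hx => ?_
      by_contra hxm
      exact hx (by simp [hf, show ¬ x < m from hxm])
  have hSPlim : Tendsto SP atTop (𝓝 1) := by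
    have := ENNReal.tendsto_nat_tsum (fun x => P x)
    rwa [P.tsum_coe] at this
  have hlim : ∀ x, Tendsto (fun m => mkPMF (f m) (htsum m) x) atTop (𝓝 (R x)) := by
    intro x
    have hTl : ∀ k, Tendsto (fun m => T m k) atTop (𝓝 (SR k)) := by
      intro k
      have := (tendsto_const_nhds (x := SR k)).min hSPlim
      rwa [min_eq_left (sum_range_le_one R k)] at this
    have h := ENNReal.Tendsto.sub (hTl (x + 1)) (hTl x) (Or.inl (hfin R (x + 1)))
    have hR : SR (x + 1) - SR x = R x := by
      simp only [hSR, Finset.sum_range_succ]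
      exact ENNReal.add_sub_cancel_left (hfin R x)
    rw [hR] at h
    refine h.congr' ?_
    filter_upwards [eventually_gt_atTop x] with m hm
    simp [hf, hm]
  calc φ R ≤ liminf (fun m => φ (mkPMF (f m) (htsum m))) atTop := hl R _ hlim
    _ ≤ liminf (fun _ : ℕ => φ P) atTop := liminf_le_liminf (Eventually.of_forall hstep)
    _ = φ P := liminf_const _

/-! ### Jensen's inequality -/

/-- Jensen's inequality for finitely many weights of total mass at most one. -/
theorem sum_le_of_subconvex {φ : PMF ℕ → ℝ≥0∞} (hc : IsConcave φ) {ι : Type*} (s : Finset ι)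
    (w : ι → ℝ≥0∞) (P : ι → PMF ℕ) (R : PMF ℕ) (h : ∀ x, ∑ i ∈ s, w i * P i x ≤ R x) :
    ∑ i ∈ s, w i * φ (P i) ≤ φ R := by
  classical
  -- With an inequality in the hypothesis the induction can peel off one term: what is left lies
  -- below `R - w i * P i`, which is renormalized by `1 - w i`.
  induction s using Finset.induction_on generalizing w R with
  | empty => simp
  | insert i s hi ih =>
    simp only [Finset.sum_insert hi] at h ⊢
    have hle : ∀ x, w i * P i x ≤ R x := fun x => le_self_add.trans (h x)
    have hw1 : w i ≤ 1 := by
      have := ENNReal.tsum_le_tsum hle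
      rwa [ENNReal.tsum_mul_left, (P i).tsum_coe, R.tsum_coe, mul_one] at this
    have hwt : w i ≠ ∞ := (hw1.trans_lt ENNReal.one_lt_top).ne
    have hrest : ∀ x, ∑ j ∈ s, w j * P j x ≤ R x - w i * P i x := fun x =>
      ENNReal.le_sub_of_add_le_left (ENNReal.mul_ne_top hwt (apply_ne_top _ _)) (h x)
    have hts : ∑' x, (R x - w i * P i x) = 1 - w i := by
      rw [ENNReal.tsum_sub _ hle, ENNReal.tsum_mul_left, (P i).tsum_coe, R.tsum_coe, mul_one]
      rw [ENNReal.tsum_mul_left, (P i).tsum_coe, mul_one]; exact hwt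
    -- Nothing remains to be renormalized: `P i = R`, and all other weights vanish.
    by_cases hb : 1 - w i = 0
    · have hw : w i = 1 := le_antisymm hw1 (tsub_eq_zero_iff_le.1 hb)
      have hR : P i = R := eq_of_forall_le fun x => by simpa [hw] using hle x
      have hz : ∀ j ∈ s, w j = 0 := by
        intro j hj
        rw [hb, ENNReal.tsum_eq_zero] at hts
        have h0 : ∀ x, w j * P j x = 0 := fun x => by
          have := (Finset.single_le_sum (f := fun j => w j * P j x) (fun _ _ => zero_le) hj).trans
            (hrest x)
          rw [hts x] at this
          simpa using this
        have := ENNReal.tsum_mul_left (a := w j) (f := fun x => P j x)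
        rw [(P j).tsum_coe, mul_one] at this
        rw [← this]
        simp [h0]
      rw [Finset.sum_eq_zero fun j hj => by rw [hz j hj, zero_mul], hw, hR]
      simp
    · have hbt : 1 - w i ≠ ∞ := ENNReal.sub_ne_top ENNReal.one_ne_top
      set T : PMF ℕ := mkPMF (fun x => (1 - w i)⁻¹ * (R x - w i * P i x)) (by
        rw [ENNReal.tsum_mul_left, hts, ENNReal.inv_mul_cancel hb hbt]) with hT
      have h1 := ih (fun j => (1 - w i)⁻¹ * w j) T fun x => by
        simp only [mul_assoc, ← Finset.mul_sum, hT, mkPMF_apply]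
        gcongr
        exact hrest x
      simp only [mul_assoc, ← Finset.mul_sum] at h1
      have h2 := hc (P i) T R (w i) (1 - w i) (add_tsub_cancel_of_le hw1) fun x => by
        simp only [hT, mkPMF_apply]
        rw [← mul_assoc, ENNReal.mul_inv_cancel hb hbt, one_mul, add_tsub_cancel_of_le (hle x)]
      refine le_trans ?_ h2
      gcongr
      calc ∑ j ∈ s, w j * φ (P j)
          = (1 - w i) * ((1 - w i)⁻¹ * ∑ j ∈ s, w j * φ (P j)) := by
            rw [← mul_assoc, ENNReal.mul_inv_cancel hb hbt, one_mul]
        _ ≤ (1 - w i) * φ T := by gcongr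

/-- A finite subfamily of the weights has total mass below one in general, hence the deficit allowed
in `sum_le_of_subconvex`. -/
theorem tsum_le_of_convex {φ : PMF ℕ → ℝ≥0∞} (hc : IsConcave φ) {ι : Type*}
    (w : ι → ℝ≥0∞) (P : ι → PMF ℕ) (R : PMF ℕ) (h : ∀ x, ∑' i, w i * P i x ≤ R x) :
    ∑' i, w i * φ (P i) ≤ φ R := by
  rw [ENNReal.tsum_eq_iSup_sum]
  exact iSup_le fun s =>
    sum_le_of_subconvex hc s w P R fun x => (ENNReal.sum_le_tsum s).trans (h x)

section Barycenter

variable {Ω : Type*} [MeasurableSpace Ω]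

/-- The barycenter of a random distribution. -/
def bary (μ : Measure Ω) [IsProbabilityMeasure μ] (P : Ω → PMF ℕ)
    (hP : ∀ x, Measurable fun ω => P ω x) : PMF ℕ :=
  mkPMF (fun x => ∫⁻ ω, P ω x ∂μ) (by
    rw [← lintegral_tsum fun x => (hP x).aemeasurable]
    simp [PMF.tsum_coe])

theorem bary_apply (μ : Measure Ω) [IsProbabilityMeasure μ] (P : Ω → PMF ℕ)
    (hP : ∀ x, Measurable fun ω => P ω x) (x : ℕ) : bary μ P hP x = ∫⁻ ω, P ω x ∂μ := rfl

/-- The barycenter over the event `A`, a default value if `A` is a null set. -/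
def baryOn (μ : Measure Ω) [IsProbabilityMeasure μ] (P : Ω → PMF ℕ)
    (hP : ∀ x, Measurable fun ω => P ω x) (A : Set Ω) : PMF ℕ :=
  if h : μ A = 0 then PMF.pure 0 else
    haveI := cond_isProbabilityMeasure h
    bary (μ[|A]) P hP

theorem mul_baryOn (μ : Measure Ω) [IsProbabilityMeasure μ] (P : Ω → PMF ℕ)
    (hP : ∀ x, Measurable fun ω => P ω x) (A : Set Ω) (x : ℕ) :
    μ A * baryOn μ P hP A x = ∫⁻ ω in A, P ω x ∂μ := by
  by_cases h : μ A = 0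
  · rw [h, zero_mul, Measure.restrict_eq_zero.2 h, lintegral_zero_measure]
  · rw [baryOn, dif_neg h, bary_apply, ProbabilityTheory.cond, lintegral_smul_measure,
      smul_eq_mul, ← mul_assoc, ENNReal.mul_inv_cancel h (measure_ne_top _ _), one_mul]

end Barycenter

section Barycenter

/-- The cell of `ω` in the partition of precision `1 / n`: the masses of the first `n` symbols in
units of `1 / n`, rounded down. -/
def cell {Ω : Type*} (P : Ω → PMF ℕ) (n : ℕ) (ω : Ω) : Fin n → ℕ := fun x => ⌊n * (P ω x).toReal⌋₊

theorem measurable_cell {Ω : Type*} [MeasurableSpace Ω] {P : Ω → PMF ℕ} (hP : ∀ x, Measurable fun ω => P ω x) (n : ℕ) :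
    Measurable (cell P n) :=
  measurable_pi_lambda _ fun x => Nat.measurable_floor.comp ((hP x).ennreal_toReal.const_mul _)

theorem apply_le_of_cell_eq {Ω : Type*} {P : Ω → PMF ℕ} {n : ℕ} {ω ω' : Ω} (h : cell P n ω = cell P n ω')
    {x : ℕ} (hx : x < n) : P ω x ≤ P ω' x + (n : ℝ≥0∞)⁻¹ := by
  have hn : (0 : ℝ) < n := by exact_mod_cast lt_of_le_of_lt (Nat.zero_le x) hx
  have h1 : ⌊n * (P ω x).toReal⌋₊ = ⌊n * (P ω' x).toReal⌋₊ := congrFun h ⟨x, hx⟩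
  have h2 := Nat.lt_floor_add_one (n * (P ω x).toReal)
  have h3 := Nat.floor_le (mul_nonneg hn.le (ENNReal.toReal_nonneg (a := P ω' x)))
  rw [h1] at h2
  have h4 : (P ω x).toReal ≤ (P ω' x).toReal + (n : ℝ)⁻¹ := by
    have : n * (P ω x).toReal ≤ n * ((P ω' x).toReal + (n : ℝ)⁻¹) := by
      rw [mul_add, mul_inv_cancel₀ hn.ne']; linarith
    exact le_of_mul_le_mul_left this hn
  have hinv : (n : ℝ≥0∞)⁻¹ ≠ ∞ := ENNReal.inv_ne_top.2 (by exact_mod_cast hn.ne')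
  rw [← ENNReal.toReal_le_toReal (apply_ne_top _ _) (ENNReal.add_ne_top.2 ⟨apply_ne_top _ _, hinv⟩),
    ENNReal.toReal_add (apply_ne_top _ _) hinv, ENNReal.toReal_inv, ENNReal.toReal_natCast]
  exact h4

variable {Ω : Type*} [MeasurableSpace Ω]

/-- Jensen's inequality. -/
theorem lintegral_le_bary {φ : PMF ℕ → ℝ≥0∞} (hc : IsConcave φ) (hl : IsLSC φ) (μ : Measure Ω)
    [IsProbabilityMeasure μ] (P : Ω → PMF ℕ) (hP : ∀ x, Measurable fun ω => P ω x) :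
    ∫⁻ ω, φ (P ω) ∂μ ≤ φ (bary μ P hP) := by
  -- `φ` is not assumed measurable. Replacing `P ω` by its mean over the cell of `ω` gives a
  -- function of a countable-valued variable, for which measurability is free and the countable
  -- inequality applies. Refining the cells, lower semicontinuity and Fatou's lemma conclude.
  set B : (n : ℕ) → (Fin n → ℕ) → PMF ℕ := fun n c => baryOn μ P hP (cell P n ⁻¹' {c}) with hB
  have hcell : ∀ n c, MeasurableSet (cell P n ⁻¹' {c}) := fun n c =>
    measurable_cell hP n (measurableSet_singleton c)
  have hmeas : ∀ n, Measurable fun ω => φ (B n (cell P n ω)) := fun n =>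
    (measurable_of_countable fun c => φ (B n c)).comp (measurable_cell hP n)
  have hcells : ∀ n, ∫⁻ ω, φ (B n (cell P n ω)) ∂μ ≤ φ (bary μ P hP) := by
    intro n
    rw [← lintegral_map (f := fun c => φ (B n c)) (measurable_of_countable _)
      (measurable_cell hP n), lintegral_countable']
    simp only [Measure.map_apply (measurable_cell hP n) (measurableSet_singleton _)]
    simp only [mul_comm]
    refine tsum_le_of_convex hc _ _ _ fun x => ?_
    simp only [hB, mul_baryOn, bary_apply]
    refine le_of_eq ?_
    rw [← lintegral_iUnion (fun c => hcell n c)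
      (fun c c' h => Set.disjoint_left.2 fun ω h1 h2 => h (h1.symm.trans h2)),
      ← Set.preimage_iUnion, Set.iUnion_of_singleton, Set.preimage_univ, Measure.restrict_univ]
  -- Only countably many cells exist, so almost every `ω` avoids the null cells, where `baryOn` is a
  -- default value.
  have hae : ∀ᵐ ω ∂μ, ∀ n, μ (cell P n ⁻¹' {cell P n ω}) ≠ 0 := by
    rw [ae_all_iff]
    intro n
    have : {ω | ¬ μ (cell P n ⁻¹' {cell P n ω}) ≠ 0}
        = ⋃ c ∈ {c | μ (cell P n ⁻¹' {c}) = 0}, cell P n ⁻¹' {c} := by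
      ext ω
      simp
    rw [ae_iff, this, measure_biUnion_null_iff (Set.to_countable _)]
    exact fun c hc => hc
  have hlim : ∀ ω, (∀ n, μ (cell P n ⁻¹' {cell P n ω}) ≠ 0) →
      ∀ x, Tendsto (fun n => B n (cell P n ω) x) atTop (𝓝 (P ω x)) := by
    intro ω hω x
    have hinv : Tendsto (fun n : ℕ => (n : ℝ≥0∞)⁻¹) atTop (𝓝 0) :=
      ENNReal.tendsto_inv_nat_nhds_zero
    have hup : Tendsto (fun n : ℕ => P ω x + (n : ℝ≥0∞)⁻¹) atTop (𝓝 (P ω x)) := by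
      simpa using tendsto_const_nhds.add hinv
    have hlow : Tendsto (fun n : ℕ => P ω x - (n : ℝ≥0∞)⁻¹) atTop (𝓝 (P ω x)) := by
      simpa using ENNReal.Tendsto.sub tendsto_const_nhds hinv (Or.inl (apply_ne_top _ _))
    have hB' : ∀ n, B n (cell P n ω) x = ∫⁻ ω', P ω' x ∂(μ[|cell P n ⁻¹' {cell P n ω}]) := by
      intro n
      simp only [hB, baryOn]
      rw [dif_neg (hω n), bary_apply]
    refine tendsto_of_tendsto_of_tendsto_of_le_of_le' hlow hup ?_ ?_
    · filter_upwards [eventually_gt_atTop x] with n hn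
      have := cond_isProbabilityMeasure (hω n)
      rw [hB' n]
      calc P ω x - (n : ℝ≥0∞)⁻¹
          = ∫⁻ _, (P ω x - (n : ℝ≥0∞)⁻¹) ∂(μ[|cell P n ⁻¹' {cell P n ω}]) := by simp
        _ ≤ _ := by
          refine lintegral_mono_ae ?_
          filter_upwards [ae_cond_mem (hcell n (cell P n ω))] with ω' hω'
          exact tsub_le_iff_right.2 (apply_le_of_cell_eq (Eq.symm hω') hn)
    · filter_upwards [eventually_gt_atTop x] with n hn
      have := cond_isProbabilityMeasure (hω n)
      rw [hB' n]
      calc _ ≤ ∫⁻ _, (P ω x + (n : ℝ≥0∞)⁻¹) ∂(μ[|cell P n ⁻¹' {cell P n ω}]) := by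
            refine lintegral_mono_ae ?_
            filter_upwards [ae_cond_mem (hcell n (cell P n ω))] with ω' hω'
            exact apply_le_of_cell_eq hω' hn
        _ = _ := by simp
  calc ∫⁻ ω, φ (P ω) ∂μ
      ≤ ∫⁻ ω, liminf (fun n => φ (B n (cell P n ω))) atTop ∂μ := by
        refine lintegral_mono_ae ?_
        filter_upwards [hae] with ω hω
        exact hl _ _ (hlim ω hω)
    _ ≤ liminf (fun n => ∫⁻ ω, φ (B n (cell P n ω)) ∂μ) atTop := lintegral_liminf_le hmeas
    _ ≤ liminf (fun _ : ℕ => φ (bary μ P hP)) atTop :=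
        liminf_le_liminf (Eventually.of_forall hcells)
    _ = φ (bary μ P hP) := liminf_const _

theorem setLIntegral_le_baryOn {φ : PMF ℕ → ℝ≥0∞} (hc : IsConcave φ) (hl : IsLSC φ) (μ : Measure Ω)
    [IsProbabilityMeasure μ] (P : Ω → PMF ℕ) (hP : ∀ x, Measurable fun ω => P ω x) (A : Set Ω) :
    ∫⁻ ω in A, φ (P ω) ∂μ ≤ μ A * φ (baryOn μ P hP A) := by
  by_cases h : μ A = 0
  · simp [Measure.restrict_eq_zero.2 h]
  · have := cond_isProbabilityMeasure h
    have h1 := lintegral_le_bary hc hl (μ[|A]) P hP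
    have h2 : ∫⁻ ω, φ (P ω) ∂(μ[|A]) = (μ A)⁻¹ * ∫⁻ ω in A, φ (P ω) ∂μ := by
      rw [ProbabilityTheory.cond, lintegral_smul_measure, smul_eq_mul]
    rw [h2] at h1
    rw [baryOn, dif_neg h]
    calc ∫⁻ ω in A, φ (P ω) ∂μ = μ A * ((μ A)⁻¹ * ∫⁻ ω in A, φ (P ω) ∂μ) := by
          rw [← mul_assoc, ENNReal.mul_inv_cancel h (measure_ne_top _ _), one_mul]
      _ ≤ _ := by gcongr

/-- Equality in Jensen's inequality for strictly concave functions. -/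
theorem ae_eq_bary {φ : PMF ℕ → ℝ≥0∞} (hc : IsConcave φ) (hl : IsLSC φ) (hst : IsStrict φ)
    (μ : Measure Ω) [IsProbabilityMeasure μ] (P : Ω → PMF ℕ) (hP : ∀ x, Measurable fun ω => P ω x)
    (hfin : φ (bary μ P hP) ≠ ∞) (heq : φ (bary μ P hP) ≤ ∫⁻ ω, φ (P ω) ∂μ) (x : ℕ) :
    ∀ᵐ ω ∂μ, P ω x = bary μ P hP x := by
  set R := bary μ P hP with hR
  set A : Set Ω := {ω | R x < P ω x} with hA
  have hAm : MeasurableSet A := measurableSet_lt measurable_const (hP x)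
  have hRx : ∫⁻ ω, P ω x ∂μ = R x := rfl
  have hconst : ∫⁻ _, R x ∂μ = R x := by simp
  -- If `A` is null, then `P ω x ≤ R x` almost everywhere with equal means, hence equality.
  -- Otherwise `A` and its complement both have positive measure, `R` is a proper mixture of two
  -- distinct conditional barycenters, and strictness contradicts Jensen's inequality on the two
  -- pieces.
  by_cases hA0 : μ A = 0
  · have hle : ∀ᵐ ω ∂μ, P ω x ≤ R x := by
      rw [ae_iff]; simpa [hA] using hA0
    refine ae_eq_of_ae_le_of_lintegral_le hle ?_ aemeasurable_const ?_
    · rw [hRx]; exact apply_ne_top _ _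
    · rw [hRx, hconst]
  exfalso
  have hAc0 : μ Aᶜ ≠ 0 := by
    intro h
    have hlt : ∀ᵐ ω ∂μ, R x < P ω x := by
      rw [ae_iff]; simpa [hA, Set.compl_def] using h
    have := lintegral_strict_mono (μ := μ) (IsProbabilityMeasure.ne_zero μ) (hP x).aemeasurable
      (by rw [hconst]; exact apply_ne_top _ _) hlt
    rw [hconst, hRx] at this
    exact lt_irrefl _ this
  have hab : μ A + μ Aᶜ = 1 := prob_add_prob_compl hAm
  have hmix : ∀ z, R z = μ A * baryOn μ P hP A z + μ Aᶜ * baryOn μ P hP Aᶜ z := by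
    intro z
    rw [mul_baryOn, mul_baryOn, lintegral_add_compl _ hAm]
    rfl
  have hle := hc _ _ _ _ _ hab hmix
  -- Concavity itself yields the finiteness that strictness requires: each weighted value is at most
  -- `φ R`.
  have hbound : ∀ {a b c : ℝ≥0∞}, a ≠ 0 → a * b ≤ c → c ≠ ∞ → b ≠ ∞ := by
    rintro a b c ha h hc rfl
    rw [ENNReal.mul_top ha] at h
    exact hc (top_le_iff.1 h)
  have hne : baryOn μ P hP A ≠ baryOn μ P hP Aᶜ := by
    intro h
    have hz : baryOn μ P hP A x = R x := by
      rw [hmix x, ← h, ← add_mul, hab, one_mul]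
    have := cond_isProbabilityMeasure hA0
    have hz' : ∫⁻ ω, P ω x ∂(μ[|A]) = R x := by
      rw [← hz, baryOn, dif_neg hA0, bary_apply]
    have := lintegral_strict_mono (μ := μ[|A]) (f := fun _ => R x)
      (IsProbabilityMeasure.ne_zero _) (hP x).aemeasurable (by simpa using apply_ne_top R x)
      (ae_cond_mem hAm)
    rw [hz'] at this
    simp at this
  have hlt := hst _ _ R (μ A) (μ Aᶜ) hab hA0 hAc0 hne
    (hbound hA0 (le_self_add.trans hle) hfin) (hbound hAc0 (le_add_self.trans hle) hfin) hmix
  have h1 := setLIntegral_le_baryOn hc hl μ P hP A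
  have h2 := setLIntegral_le_baryOn hc hl μ P hP Aᶜ
  have h3 := lintegral_add_compl (fun ω => φ (P ω)) hAm (μ := μ)
  rw [← h3] at heq
  exact absurd (heq.trans (add_le_add h1 h2)) (not_le.2 hlt)

end Barycenter

/-- Strict Schur concavity. -/
theorem eq_of_majorize {φ : PMF ℕ → ℝ≥0∞} (hs : IsSymmetric φ) (hc : IsConcave φ) (hl : IsLSC φ)
    (hst : IsStrict φ) {P : PMF ℕ} (hP : Antitone P) (R : PMF ℕ)
    (hmaj : ∀ k, ∑ i ∈ Finset.range k, P i ≤ ∑ i ∈ Finset.range k, R i) (hfin : φ P ≠ ∞)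
    (heq : φ P ≤ φ R) : R = P := by
  by_contra hne
  have hle := le_of_majorize hs hc hl hP R hmaj
  have hhalf : (2⁻¹ : ℝ≥0∞) + 2⁻¹ = 1 := ENNReal.inv_two_add_inv_two
  -- The midpoint of `R` and `P` still majorizes `P`, so `φ` cannot be strictly larger there.
  have h1 := hst R P (mix _ _ hhalf R P) _ _ hhalf (by simp) (by simp) hne
    (hle.trans_lt hfin.lt_top).ne hfin (mix_apply _ _ hhalf R P)
  have h2 : φ (mix _ _ hhalf R P) ≤ φ P := by
    refine le_of_majorize hs hc hl hP _ fun k => ?_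
    simp only [mix_apply, Finset.sum_add_distrib, ← Finset.mul_sum]
    calc ∑ i ∈ Finset.range k, P i
        = 2⁻¹ * ∑ i ∈ Finset.range k, P i + 2⁻¹ * ∑ i ∈ Finset.range k, P i := by
          rw [← add_mul, hhalf, one_mul]
      _ ≤ _ := add_le_add (mul_le_mul' le_rfl (hmaj k)) le_rfl
  rw [le_antisymm hle heq, ← add_mul, hhalf, one_mul] at h1
  exact absurd h2 (not_le.2 h1)

/-! ### The type-1 Fano distribution -/

/-- The sum of the `k` largest masses of `Q`. -/
def topSum (Q : PMF ℕ) (k : ℕ) : ℝ := ∑ i ∈ Finset.range k, (rearr Q i).toReal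

theorem q_succ (Q : PMF ℕ) (i : ℕ) : q Q (i + 1) = (rearr Q i).toReal := rfl

theorem topSum_succ (Q : PMF ℕ) (k : ℕ) : topSum Q (k + 1) = topSum Q k + (rearr Q k).toReal :=
  Finset.sum_range_succ _ _

theorem sum_Icc_q (Q : PMF ℕ) (k : ℕ) : ∑ x ∈ Finset.Icc 1 k, q Q x = topSum Q k := by
  induction k with
  | zero => simp [topSum]
  | succ k ih => rw [Finset.sum_Icc_succ_top (by omega), ih, topSum_succ, q_succ]

theorem sum_Ico_q (Q : PMF ℕ) (j : ℕ) : ∑ x ∈ Finset.Ico 1 (j + 1), q Q x = topSum Q j := by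
  rw [← sum_Icc_q, Finset.Ico_add_one_right_eq_Icc]

theorem marginalError_eq (Q : PMF ℕ) (L : ℕ) : marginalError Q L = 1 - topSum Q L := by
  rw [marginalError, sum_Icc_q]

theorem V_succ {Q : PMF ℕ} {L j : ℕ} {ε : ℝ} (h : j < L) :
    V Q L ε (j + 1) = (1 - ε - topSum Q j) / ((L : ℝ) - j) := by
  rw [V, if_pos (Nat.succ_le_of_lt h), sum_Ico_q]
  push_cast
  ring_nf

theorem W_coe (Q : PMF ℕ) (L : ℕ) (ε : ℝ) (k : ℕ) : W Q L ε (k : ℕ∞)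
    = if k = L then -1 else ((∑ x ∈ Finset.Icc 1 k, q Q x) - (1 - ε)) / ((k : ℝ) - L) := rfl

theorem W_of_lt {Q : PMF ℕ} {L k : ℕ} {ε : ℝ} (h : L < k) :
    W Q L ε (k : ℕ∞) = (topSum Q k - (1 - ε)) / ((k : ℝ) - L) := by
  rw [W_coe, if_neg h.ne', sum_Icc_q]

theorem toReal_rearr_antitone (Q : PMF ℕ) : Antitone fun i => (rearr Q i).toReal := fun _ _ h =>
  ENNReal.toReal_mono (apply_ne_top _ _) (rearr_antitone Q h)

theorem hasSum_toReal (P : PMF ℕ) : HasSum (fun i => (P i).toReal) 1 := by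
  have h := ENNReal.hasSum_toReal (f := fun i => P i) (by rw [P.tsum_coe]; exact ENNReal.one_ne_top)
  rwa [← ENNReal.tsum_toReal_eq (fun i => apply_ne_top _ _), P.tsum_coe, ENNReal.toReal_one] at h

theorem tendsto_topSum (Q : PMF ℕ) : Tendsto (topSum Q) atTop (𝓝 1) :=
  (hasSum_toReal (rearr Q)).tendsto_sum_nat

theorem topSum_mono (Q : PMF ℕ) : Monotone (topSum Q) := fun _ _ h =>
  Finset.sum_le_sum_of_subset_of_nonneg (Finset.range_subset_range.2 h)
    fun _ _ _ => ENNReal.toReal_nonneg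

theorem topSum_le_one (Q : PMF ℕ) (k : ℕ) : topSum Q k ≤ 1 :=
  (topSum_mono Q).ge_of_tendsto (tendsto_topSum Q) k

theorem mul_le_sum_sub {r : ℕ → ℝ} (hr : Antitone r) {m n k : ℕ} (hmn : m ≤ n)
    (hk : n ≤ k + 1) : ((n : ℝ) - m) * r k
      ≤ ∑ i ∈ Finset.range n, r i - ∑ i ∈ Finset.range m, r i := by
  rw [← Finset.sum_Ico_eq_sub _ hmn]
  have h := Finset.card_nsmul_le_sum (Finset.Ico m n) r (r k) fun i hi =>
    hr (by have := (Finset.mem_Ico.1 hi).2; omega)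
  rwa [Nat.card_Ico, nsmul_eq_mul, Nat.cast_sub hmn] at h

theorem sum_sub_le_mul {r : ℕ → ℝ} (hr : Antitone r) {m n k : ℕ} (hmn : m ≤ n)
    (hk : k ≤ m) : ∑ i ∈ Finset.range n, r i - ∑ i ∈ Finset.range m, r i
      ≤ ((n : ℝ) - m) * r k := by
  rw [← Finset.sum_Ico_eq_sub _ hmn]
  have h := Finset.sum_le_card_nsmul (Finset.Ico m n) r (r k) fun i hi =>
    hr (by have := (Finset.mem_Ico.1 hi).1; omega)
  rwa [Nat.card_Ico, nsmul_eq_mul, Nat.cast_sub hmn] at h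

/-- Partial sums of an antitone sequence are concave. -/
theorem sum_range_concave {r : ℕ → ℝ} (hr : Antitone r) {j k l : ℕ} (hjk : j ≤ k) (hkl : k ≤ l) :
    ((l : ℝ) - k) * ∑ i ∈ Finset.range j, r i + ((k : ℝ) - j) * ∑ i ∈ Finset.range l, r i
      ≤ ((l : ℝ) - j) * ∑ i ∈ Finset.range k, r i := by
  have h1 := mul_le_sum_sub hr hjk (Nat.le_succ k)
  have h2 := sum_sub_le_mul hr hkl (le_refl k)
  have hjk' : (0 : ℝ) ≤ (k : ℝ) - j := by rw [sub_nonneg]; exact_mod_cast hjk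
  have hkl' : (0 : ℝ) ≤ (l : ℝ) - k := by rw [sub_nonneg]; exact_mod_cast hkl
  have h3 := mul_le_mul_of_nonneg_left h1 hkl'
  have h4 := mul_le_mul_of_nonneg_left h2 hjk'
  linarith

/-- The parameters `j = J - 1`, `K = K₁`, `v = 𝒱(J)`, `w = 𝒲(K₁)` of the type-1 Fano distribution
in the case that the sum of the `L` largest masses is less than `c = 1 - ε`. -/
structure Shape (Q : PMF ℕ) (L : ℕ) (c : ℝ) (j : ℕ) (K : ℕ∞) (v w : ℝ) : Prop where
  j_lt : j < L
  lt_K : (L : ℕ∞) < K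
  v_eq : topSum Q j + ((L : ℝ) - j) * v = c
  v_le : ∀ x < j, v ≤ (rearr Q x).toReal
  lt_v : (rearr Q j).toReal < v
  w_nonneg : 0 ≤ w
  w_lt : ∀ x : ℕ, (x : ℕ∞) < K → w < (rearr Q x).toReal
  le_w : ∀ x : ℕ, K ≤ x → (rearr Q x).toReal ≤ w
  of_top : K = ⊤ → w = 0 ∧ c = 1
  of_coe : ∀ k : ℕ, K = k → c + ((k : ℝ) - L) * w = topSum Q k

/-- The mass function of the type-1 Fano distribution in terms of its parameters. -/
def shapeMass (Q : PMF ℕ) (L j : ℕ) (K : ℕ∞) (v w : ℝ) (x : ℕ) : ℝ :=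
  if x < j ∨ K ≤ x then (rearr Q x).toReal else if x < L then v else w

theorem J_mem (Q : PMF ℕ) {L : ℕ} (hL : 1 ≤ L) (ε : ℝ) :
    1 ≤ J Q L ε ∧ q Q (J Q L ε) < V Q L ε (J Q L ε) := by
  -- The index `L + 1` always qualifies: Q↓(L + 1) ≤ Q↓(2) ≤ 1/2 < 1 = 𝒱(L + 1).
  refine Nat.sInf_mem (s := {j : ℕ | 1 ≤ j ∧ q Q j < V Q L ε j}) ⟨L + 1, by omega, ?_⟩
  have h := topSum_le_one Q (L + 1)
  have hm := topSum_mono Q (show 1 + 1 ≤ L + 1 by omega)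
  have ha : (rearr Q 1).toReal ≤ (rearr Q 0).toReal := toReal_rearr_antitone Q zero_le_one
  have hb : (rearr Q L).toReal ≤ (rearr Q 1).toReal := toReal_rearr_antitone Q hL
  rw [topSum_succ, topSum_succ] at hm
  have h0 : topSum Q 0 = 0 := by simp [topSum]
  rw [q_succ, V, if_neg (by omega)]
  linarith

theorem V_le_of_lt_J {Q : PMF ℕ} {L i : ℕ} {ε : ℝ} (h : i + 1 < J Q L ε) :
    V Q L ε (i + 1) ≤ (rearr Q i).toReal := by
  by_contra hcon
  exact Nat.notMem_of_lt_sInf h ⟨by omega, by rw [q_succ]; exact not_le.1 hcon⟩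

theorem coe_le_K {Q : PMF ℕ} {L n : ℕ} {ε : ℝ} (hn : L ≤ n) (h : W Q L ε n < q Q n) :
    (n : ℕ∞) ≤ K Q L ε :=
  le_sSup ⟨n, rfl, hn, h⟩

/-- A finite supremum of a nonempty set in `ℕ∞` is attained; the convention 𝒲(L) = -1 puts `L` into
the set. -/
theorem W_lt_of_K_eq_coe {Q : PMF ℕ} {L k : ℕ} {ε : ℝ} (h : K Q L ε = k) :
    L ≤ k ∧ W Q L ε k < q Q k := by
  have hne : {n : ℕ∞ | ∃ m : ℕ, n = m ∧ L ≤ m ∧ W Q L ε m < q Q m}.Nonempty := by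
    refine ⟨L, L, rfl, le_rfl, ?_⟩
    rw [W_coe, if_pos rfl, q]
    have : 0 ≤ (rearr Q (L - 1)).toReal := ENNReal.toReal_nonneg
    linarith
  have hlt : sSup {n : ℕ∞ | ∃ m : ℕ, n = m ∧ L ≤ m ∧ W Q L ε m < q Q m} < ⊤ := by
    change K Q L ε < ⊤
    rw [h]; exact ENat.natCast_lt_top k
  have := hne.to_subtype
  obtain ⟨m, hm, hm'⟩ := ENat.sSup_mem_of_nonempty_of_lt_top hlt
  have : K Q L ε = m := hm
  rw [h] at this
  obtain rfl : k = m := by exact_mod_cast this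
  exact hm'

theorem exists_W_lt_of_K_eq_top {Q : PMF ℕ} {L : ℕ} {ε : ℝ} (h : K Q L ε = ⊤) (N : ℕ) :
    ∃ n, N < n ∧ L ≤ n ∧ W Q L ε n < q Q n := by
  have hlt : (N : ℕ∞) < sSup {k : ℕ∞ | ∃ n : ℕ, k = n ∧ L ≤ n ∧ W Q L ε n < q Q n} := by
    change _ < K Q L ε
    rw [h]; exact ENat.natCast_lt_top N
  obtain ⟨_, ⟨n, rfl, hn⟩, hN⟩ := lt_sSup_iff.1 hlt
  exact ⟨n, by exact_mod_cast hN, hn⟩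

/-- Here 𝒱(j) is the mean of Q↓ over j, …, L, hence at most Q↓(j), and 𝒲(k) is its mean over L + 1,
…, k, hence at least Q↓(k). So J = L + 1 and K₁ = L, and nothing is flattened. -/
theorem fanoMass_of_eq {Q : PMF ℕ} {L : ℕ} (hL : 1 ≤ L) {ε : ℝ} (h : topSum Q L = 1 - ε) (x : ℕ) :
    fanoMass Q L ε (x + 1) = (rearr Q x).toReal := by
  have hJ : L < J Q L ε := by
    by_contra hcon
    obtain ⟨h1, h2⟩ := J_mem Q hL ε
    obtain ⟨i, hi⟩ : ∃ i, J Q L ε = i + 1 := ⟨J Q L ε - 1, by omega⟩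
    have hiL : i < L := by omega
    rw [hi, q_succ, V_succ hiL, ← h, lt_div_iff₀ (by rw [sub_pos]; exact_mod_cast hiL)] at h2
    have := sum_sub_le_mul (toReal_rearr_antitone Q) hiL.le (le_refl i)
    simp only [topSum] at h2
    linarith
  have hK : K Q L ε ≤ L := by
    refine sSup_le ?_
    rintro _ ⟨n, rfl, hn, hW⟩
    by_contra hcon
    have hLn : L < n := by exact_mod_cast not_le.1 hcon
    obtain ⟨i, rfl⟩ : ∃ i, n = i + 1 := ⟨n - 1, by omega⟩
    rw [q_succ, W_of_lt hLn, ← h, div_lt_iff₀ (by rw [sub_pos]; exact_mod_cast hLn)] at hW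
    have := mul_le_sum_sub (toReal_rearr_antitone Q) hLn.le (le_refl (i + 1))
    simp only [topSum] at hW
    linarith
  rw [fanoMass, if_pos, q_succ]
  by_cases hx : x + 1 < J Q L ε
  · exact Or.inl hx
  · exact Or.inr (lt_of_le_of_lt hK (by exact_mod_cast (by omega)))

/-- 𝒱 and 𝒲 solve linear mass balances. Cross-multiplied, 𝒱(i) ≤ Q↓(i) is equivalent to 𝒱(i + 1) ≤
Q↓(i) for i < L, and Q↓(k + 1) ≤ 𝒲(k + 1) to Q↓(k + 1) ≤ 𝒲(k) for k > L. So the extremality of J and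
K₁ gives the ordering at the ends of the two plateaus. -/
theorem shape_of_lt {Q : PMF ℕ} {L : ℕ} (hL : 1 ≤ L) {ε : ℝ} (hε : 0 ≤ ε)
    (h : topSum Q L < 1 - ε) :
    Shape Q L (1 - ε) (J Q L ε - 1) (K Q L ε) (V Q L ε (J Q L ε)) (W Q L ε (K Q L ε)) := by
  have anti := toReal_rearr_antitone Q
  have nonneg : ∀ i, 0 ≤ (rearr Q i).toReal := fun i => ENNReal.toReal_nonneg
  obtain ⟨h1, h2⟩ := J_mem Q hL ε
  have hJL : J Q L ε ≤ L := by
    refine Nat.sInf_le ⟨hL, ?_⟩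
    obtain ⟨l, rfl⟩ : ∃ l, L = l + 1 := ⟨L - 1, by omega⟩
    rw [V_succ (Nat.lt_succ_self l), q_succ]
    rw [topSum_succ] at h
    push_cast
    rw [lt_div_iff₀ (by linarith)]
    linarith
  obtain ⟨j, hj⟩ : ∃ j, J Q L ε = j + 1 := ⟨J Q L ε - 1, by omega⟩
  have hjL : j < L := by omega
  have hjL' : (0 : ℝ) < (L : ℝ) - j := by rw [sub_pos]; exact_mod_cast hjL
  have hLK : (L : ℕ∞) < K Q L ε := by
    have : ((L + 1 : ℕ) : ℕ∞) ≤ K Q L ε := by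
      refine coe_le_K (Nat.le_succ L) ?_
      rw [W_of_lt (Nat.lt_succ_self L), q_succ, topSum_succ]
      push_cast
      rw [div_lt_iff₀ (by linarith)]
      linarith
    exact lt_of_lt_of_le (by exact_mod_cast Nat.lt_succ_self L) this
  have hV := V_succ (Q := Q) (ε := ε) hjL
  rw [hj, Nat.add_sub_cancel]
  rw [hj, q_succ] at h2
  have hfin : ∀ k : ℕ, K Q L ε = k → L < k ∧ W Q L ε k < (rearr Q (k - 1)).toReal ∧
      1 - ε + ((k : ℝ) - L) * W Q L ε k = topSum Q k ∧ (rearr Q k).toReal ≤ W Q L ε k := by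
    intro k hk
    have hLk : L < k := by rw [hk] at hLK; exact_mod_cast hLK
    have hLk' : (0 : ℝ) < (k : ℝ) - L := by rw [sub_pos]; exact_mod_cast hLk
    refine ⟨hLk, (W_lt_of_K_eq_coe hk).2, ?_, ?_⟩
    · rw [W_of_lt hLk]; field_simp; ring
    · have hnot : ¬ W Q L ε (k + 1 : ℕ) < q Q (k + 1) := by
        intro hcon
        have := coe_le_K (by omega) hcon
        rw [hk] at this
        have : k + 1 ≤ k := by exact_mod_cast this
        omega
      rw [not_lt, q_succ, W_of_lt (by omega), le_div_iff₀ (by push_cast; linarith),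
        topSum_succ] at hnot
      rw [W_of_lt hLk, le_div_iff₀ hLk']
      push_cast at hnot
      linarith
  have htop : K Q L ε = ⊤ → 1 - ε = 1 ∧ ∀ x, 0 < (rearr Q x).toReal := by
    intro hK
    -- From 𝒲(n) < Q↓(n) and the monotonicity of Q↓ one gets `topSum Q N - (1 - ε) < (N - L) * q Q
    -- n`. Such n are arbitrarily large, and the right side tends to 0.
    have hle : ∀ N, L ≤ N → topSum Q N ≤ 1 - ε := by
      intro N hN
      have hlim : Tendsto (fun i => ((N : ℝ) - L) * (rearr Q i).toReal) atTop (𝓝 0) := by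
        have := (hasSum_toReal (rearr Q)).summable.tendsto_atTop_zero
        simpa using this.const_mul ((N : ℝ) - L)
      by_contra hcon
      have hpos : 0 < topSum Q N - (1 - ε) := by linarith
      obtain ⟨M, hM⟩ := (hlim.eventually (gt_mem_nhds hpos)).exists_forall_of_atTop
      obtain ⟨n, hn, hLn, hW⟩ := exists_W_lt_of_K_eq_top hK (max N (M + 1))
      obtain ⟨i, rfl⟩ : ∃ i, n = i + 1 := ⟨n - 1, by omega⟩
      have hLi : L < i + 1 := by omega
      rw [q_succ, W_of_lt hLi, div_lt_iff₀ (by rw [sub_pos]; exact_mod_cast hLi)] at hW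
      have h3 := mul_le_sum_sub anti (show N ≤ i + 1 by omega) (le_refl (i + 1))
      have h4 := hM i (by omega)
      simp only [topSum] at hW h4
      linarith
    have hc : 1 - ε = 1 := by
      have : 1 ≤ 1 - ε := le_of_tendsto (tendsto_topSum Q)
        ((eventually_ge_atTop L).mono hle)
      linarith
    -- If Q↓ vanished from some point on, then 𝒲(n) = 0 = Q↓(n) for all large n, contrary to K₁ = ∞.
    refine ⟨hc, fun x => lt_of_le_of_ne (nonneg x) fun hx => ?_⟩
    have hz : ∀ y, x ≤ y → (rearr Q y).toReal = 0 := fun y hy =>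
      le_antisymm (hx ▸ anti hy) (nonneg y)
    obtain ⟨n, hn, hLn, hW⟩ := exists_W_lt_of_K_eq_top hK (max L (x + 1))
    obtain ⟨i, rfl⟩ : ∃ i, n = i + 1 := ⟨n - 1, by omega⟩
    have hLi : L < i + 1 := by omega
    rw [q_succ, W_of_lt hLi, div_lt_iff₀ (by rw [sub_pos]; exact_mod_cast hLi), hz i (by omega),
      hc, zero_mul] at hW
    have h1 : topSum Q (i + 1) = 1 := by
      refine tendsto_nhds_unique (tendsto_const_nhds.congr' ?_) (tendsto_topSum Q)
      filter_upwards [eventually_ge_atTop (i + 1)] with y hy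
      refine Finset.sum_subset (Finset.range_subset_range.2 hy) fun z _ hz' => hz z ?_
      simp only [Finset.mem_range, not_lt] at hz'
      omega
    linarith
  refine ⟨hjL, hLK, ?_, ?_, h2, ?_, ?_, ?_, ?_, ?_⟩
  · rw [hV]; field_simp; ring
  · intro x hx
    obtain ⟨i, rfl⟩ : ∃ i, j = i + 1 := ⟨j - 1, by omega⟩
    have h3 : V Q L ε (i + 1) ≤ (rearr Q i).toReal := V_le_of_lt_J (by omega)
    have hiL : (0 : ℝ) < (L : ℝ) - i := by rw [sub_pos]; exact_mod_cast (by omega)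
    rw [V_succ (by omega), div_le_iff₀ hiL] at h3
    refine le_trans ?_ (anti (show x ≤ i by omega))
    rw [hV, div_le_iff₀ hjL', topSum_succ]
    push_cast
    linarith
  · rcases eq_or_ne (K Q L ε) ⊤ with hK | hK
    · rw [hK]; exact le_rfl
    · obtain ⟨k, hk⟩ := ENat.ne_top_iff_exists.1 hK
      rw [← hk]
      exact (nonneg k).trans (hfin k hk.symm).2.2.2
  · intro x hx
    rcases eq_or_ne (K Q L ε) ⊤ with hK | hK
    · rw [hK]; exact (htop hK).2 x
    · obtain ⟨k, hk⟩ := ENat.ne_top_iff_exists.1 hK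
      rw [← hk] at hx ⊢
      have : x < k := by exact_mod_cast hx
      exact lt_of_lt_of_le (hfin k hk.symm).2.1 (anti (by omega))
  · intro x hx
    have hK : K Q L ε ≠ ⊤ := by
      intro hK
      rw [hK] at hx
      exact absurd hx (not_le.2 (ENat.natCast_lt_top x))
    obtain ⟨k, hk⟩ := ENat.ne_top_iff_exists.1 hK
    rw [← hk] at hx ⊢
    exact (anti (by exact_mod_cast hx)).trans (hfin k hk.symm).2.2.2
  · intro hK
    exact ⟨by rw [hK]; rfl, (htop hK).1⟩
  · intro k hk
    rw [hk]
    exact (hfin k hk).2.2.1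

theorem fanoMass_eq_shapeMass {Q : PMF ℕ} {L : ℕ} (hL : 1 ≤ L) (ε : ℝ) (x : ℕ) :
    fanoMass Q L ε (x + 1) = shapeMass Q L (J Q L ε - 1) (K Q L ε) (V Q L ε (J Q L ε))
      (W Q L ε (K Q L ε)) x := by
  have h1 := (J_mem Q hL ε).1
  have hiff : (x + 1 < J Q L ε ∨ K Q L ε < ((x + 1 : ℕ) : ℕ∞)) ↔
      (x < J Q L ε - 1 ∨ K Q L ε ≤ x) := by
    refine or_congr (by omega) ?_
    rw [Nat.cast_add, Nat.cast_one, ENat.lt_add_one_iff (ENat.natCast_ne_top x)]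
  rw [fanoMass, shapeMass, q_succ]
  simp only [hiff, Nat.succ_le_iff]

/-! ### Partial sums and minimality of the Fano distribution -/

section Shape

variable {Q : PMF ℕ} {L j : ℕ} {c v w : ℝ} {K : ℕ∞}

theorem Shape.w_lt_v (h : Shape Q L c j K v w) : w < v :=
  (h.w_lt j (lt_trans (by exact_mod_cast h.j_lt) h.lt_K)).trans h.lt_v

theorem Shape.shapeMass_nonneg (h : Shape Q L c j K v w) (x : ℕ) :
    0 ≤ shapeMass Q L j K v w x := by
  unfold shapeMass
  split_ifs
  · exact ENNReal.toReal_nonneg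
  · exact (h.w_nonneg.trans_lt h.w_lt_v).le
  · exact h.w_nonneg

theorem Shape.shapeMass_antitone (h : Shape Q L c j K v w) :
    Antitone (shapeMass Q L j K v w) := by
  refine antitone_nat_of_succ_le fun x => ?_
  have hwv := h.w_lt_v
  have hanti := toReal_rearr_antitone Q (Nat.le_succ x)
  have hjK : (j : ℕ∞) < K := lt_trans (by exact_mod_cast h.j_lt) h.lt_K
  have hK : K ≤ x → K ≤ ((x + 1 : ℕ) : ℕ∞) := fun hx => hx.trans (by exact_mod_cast Nat.le_succ x)
  have hj := h.j_lt
  unfold shapeMass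
  by_cases h1 : x < j ∨ K ≤ x
  · rw [if_pos h1]
    rcases h1 with h1 | h1
    · split_ifs
      · exact hanti
      · exact h.v_le x h1
      · omega
    · rw [if_pos (Or.inr (hK h1))]
      exact hanti
  · rw [if_neg h1]
    push Not at h1
    by_cases h2 : x + 1 < j ∨ K ≤ ((x + 1 : ℕ) : ℕ∞)
    · rw [if_pos h2]
      have h3 : K ≤ ((x + 1 : ℕ) : ℕ∞) := h2.resolve_left (by omega)
      have h4 := h.le_w _ h3
      split_ifs
      · exact h4.trans hwv.le
      · exact h4
    · rw [if_neg h2]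
      split_ifs
      · exact le_rfl
      · omega
      · exact hwv.le
      · exact le_rfl

theorem sum_shapeMass_of_le_j {k : ℕ} (hk : k ≤ j) :
    ∑ i ∈ Finset.range k, shapeMass Q L j K v w i = topSum Q k := by
  refine Finset.sum_congr rfl fun i hi => ?_
  have := Finset.mem_range.1 hi
  rw [shapeMass, if_pos (Or.inl (by omega))]

theorem Shape.sum_of_le_L (h : Shape Q L c j K v w) {k : ℕ} (hjk : j ≤ k) (hk : k ≤ L) :
    ∑ i ∈ Finset.range k, shapeMass Q L j K v w i = topSum Q j + ((k : ℝ) - j) * v := by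
  rw [← Finset.sum_range_add_sum_Ico _ hjk, sum_shapeMass_of_le_j le_rfl]
  congr 1
  rw [Finset.sum_congr rfl (g := fun _ => v), Finset.sum_const, Nat.card_Ico, nsmul_eq_mul,
    Nat.cast_sub hjk]
  intro i hi
  have := Finset.mem_Ico.1 hi
  have hK : ¬ K ≤ i := not_le.2 (lt_trans (by exact_mod_cast (by omega : i < L)) h.lt_K)
  rw [shapeMass, if_neg (not_or.2 ⟨by omega, hK⟩), if_pos (by omega)]

theorem Shape.sum_of_le_K (h : Shape Q L c j K v w) {k : ℕ} (hLk : L ≤ k) (hk : (k : ℕ∞) ≤ K) :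
    ∑ i ∈ Finset.range k, shapeMass Q L j K v w i = c + ((k : ℝ) - L) * w := by
  rw [← Finset.sum_range_add_sum_Ico _ hLk, h.sum_of_le_L h.j_lt.le le_rfl, h.v_eq]
  congr 1
  rw [Finset.sum_congr rfl (g := fun _ => w), Finset.sum_const, Nat.card_Ico, nsmul_eq_mul,
    Nat.cast_sub hLk]
  intro i hi
  have := Finset.mem_Ico.1 hi
  have hj := h.j_lt
  have hK : ¬ K ≤ i := not_le.2 (lt_of_lt_of_le (by exact_mod_cast this.2) hk)
  rw [shapeMass, if_neg (not_or.2 ⟨by omega, hK⟩), if_neg (by omega)]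

theorem Shape.sum_of_K_le (h : Shape Q L c j K v w) {k : ℕ} (hk : K ≤ k) :
    ∑ i ∈ Finset.range k, shapeMass Q L j K v w i = topSum Q k := by
  have hK : K ≠ ⊤ := fun hK => by
    rw [hK] at hk
    exact absurd hk (not_le.2 (ENat.natCast_lt_top k))
  obtain ⟨n, rfl⟩ := ENat.ne_top_iff_exists.1 hK
  have hnk : n ≤ k := by exact_mod_cast hk
  have hLn : L < n := by exact_mod_cast h.lt_K
  rw [← Finset.sum_range_add_sum_Ico _ hnk, h.sum_of_le_K hLn.le le_rfl, h.of_coe n rfl, topSum,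
    topSum, ← Finset.sum_range_add_sum_Ico _ hnk]
  congr 1
  refine Finset.sum_congr rfl fun i hi => ?_
  have := (Finset.mem_Ico.1 hi).1
  rw [shapeMass, if_pos (Or.inr (by exact_mod_cast this))]

theorem Shape.hasSum (h : Shape Q L c j K v w) : HasSum (shapeMass Q L j K v w) 1 := by
  rw [hasSum_iff_tendsto_nat_of_nonneg h.shapeMass_nonneg]
  rcases eq_or_ne K ⊤ with hK | hK
  · refine tendsto_const_nhds.congr' ?_
    filter_upwards [eventually_ge_atTop L] with k hk
    rw [h.sum_of_le_K hk (by rw [hK]; exact le_top), (h.of_top hK).1, (h.of_top hK).2]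
    ring
  · obtain ⟨n, hn⟩ := ENat.ne_top_iff_exists.1 hK
    refine (tendsto_topSum Q).congr' ?_
    filter_upwards [eventually_ge_atTop n] with k hk
    rw [h.sum_of_K_le (by rw [← hn]; exact_mod_cast hk)]

/-- The type-1 Fano distribution with the given parameters. -/
def Shape.toPMF (h : Shape Q L c j K v w) : PMF ℕ :=
  mkPMF (fun x => ENNReal.ofReal (shapeMass Q L j K v w x)) (by
    rw [← ENNReal.ofReal_tsum_of_nonneg h.shapeMass_nonneg h.hasSum.summable, h.hasSum.tsum_eq,
      ENNReal.ofReal_one])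

theorem Shape.toPMF_apply (h : Shape Q L c j K v w) (x : ℕ) :
    h.toPMF x = ENNReal.ofReal (shapeMass Q L j K v w x) := rfl

theorem Shape.toReal_toPMF (h : Shape Q L c j K v w) (x : ℕ) :
    (h.toPMF x).toReal = shapeMass Q L j K v w x := by
  rw [h.toPMF_apply, ENNReal.toReal_ofReal (h.shapeMass_nonneg x)]

theorem Shape.toPMF_antitone (h : Shape Q L c j K v w) : Antitone h.toPMF := fun _ _ hxy =>
  ENNReal.ofReal_le_ofReal (h.shapeMass_antitone hxy)

/-- The Fano distribution is majorized by every nonincreasing distribution that majorizes `Q` and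
whose `L` largest masses add up to at least `c`. -/
theorem Shape.sum_le (h : Shape Q L c j K v w) {r : ℕ → ℝ} (hr : Antitone r) (hr0 : ∀ i, 0 ≤ r i)
    (hQ : ∀ k, topSum Q k ≤ ∑ i ∈ Finset.range k, r i) (hL : c ≤ ∑ i ∈ Finset.range L, r i)
    (k : ℕ) : ∑ i ∈ Finset.range k, shapeMass Q L j K v w i ≤ ∑ i ∈ Finset.range k, r i := by
  -- The left side agrees with `topSum` up to `j` and from `K` on, and is affine on `[j, L]` and
  -- `[L, K]`. The right side is concave, so comparison at `j`, `L` and `K` suffices. If `K = ⊤`,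
  -- then `w = 0` and the second piece is constant.
  rcases le_total k j with hkj | hkj
  · rw [sum_shapeMass_of_le_j hkj]; exact hQ k
  rcases le_total k L with hkL | hkL
  · rw [h.sum_of_le_L hkj hkL]
    have h1 := sum_range_concave hr hkj hkL
    have hjL : (0 : ℝ) < (L : ℝ) - j := by rw [sub_pos]; exact_mod_cast h.j_lt
    have h2 : (0 : ℝ) ≤ (k : ℝ) - j := by rw [sub_nonneg]; exact_mod_cast hkj
    have h3 : (0 : ℝ) ≤ (L : ℝ) - k := by rw [sub_nonneg]; exact_mod_cast hkL
    have h4 := mul_le_mul_of_nonneg_left (hQ j) h3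
    have h5 := mul_le_mul_of_nonneg_left hL h2
    refine le_of_mul_le_mul_left ?_ hjL
    refine le_trans (le_of_eq ?_) ((add_le_add h4 h5).trans h1)
    rw [← h.v_eq]; ring
  rcases le_total (k : ℕ∞) K with hkK | hkK
  · rw [h.sum_of_le_K hkL hkK]
    rcases eq_or_ne K ⊤ with hK | hK
    · rw [(h.of_top hK).1, mul_zero, add_zero]
      exact hL.trans (Finset.sum_le_sum_of_subset_of_nonneg (Finset.range_subset_range.2 hkL)
        fun i _ _ => hr0 i)
    · obtain ⟨n, rfl⟩ := ENat.ne_top_iff_exists.1 hK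
      have hkn : k ≤ n := by exact_mod_cast hkK
      have hLn : L < n := by exact_mod_cast h.lt_K
      have h1 := sum_range_concave hr hkL hkn
      have hLn' : (0 : ℝ) < (n : ℝ) - L := by rw [sub_pos]; exact_mod_cast hLn
      have h2 : (0 : ℝ) ≤ (k : ℝ) - L := by rw [sub_nonneg]; exact_mod_cast hkL
      have h3 : (0 : ℝ) ≤ (n : ℝ) - k := by rw [sub_nonneg]; exact_mod_cast hkn
      have h4 := mul_le_mul_of_nonneg_left hL h3
      have h5 := mul_le_mul_of_nonneg_left (hQ n) h2
      refine le_of_mul_le_mul_left ?_ hLn'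
      refine le_trans (le_of_eq ?_) ((add_le_add h4 h5).trans h1)
      rw [← h.of_coe n rfl]; ring
  · rw [h.sum_of_K_le hkK]; exact hQ k

end Shape

theorem toReal_sum_range (P : PMF ℕ) (k : ℕ) :
    (∑ i ∈ Finset.range k, P i).toReal = ∑ i ∈ Finset.range k, (P i).toReal :=
  ENNReal.toReal_sum fun _ _ => apply_ne_top _ _

/-- The properties of the type-1 Fano distribution `P₁` that make it optimal. -/
structure IsExtremal (Q : PMF ℕ) (L : ℕ) (ε : ℝ) (P₁ : PMF ℕ) : Prop where
  antitone : Antitone P₁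
  sum_eq : ∑ i ∈ Finset.range L, P₁ i = ENNReal.ofReal (1 - ε)
  majorized : ∀ R : PMF ℕ, Antitone R →
    (∀ k, ∑ i ∈ Finset.range k, rearr Q i ≤ ∑ i ∈ Finset.range k, R i) →
    ENNReal.ofReal (1 - ε) ≤ ∑ i ∈ Finset.range L, R i →
    ∀ k, ∑ i ∈ Finset.range k, P₁ i ≤ ∑ i ∈ Finset.range k, R i

theorem ofReal_sum_toReal (P : PMF ℕ) (k : ℕ) :
    ENNReal.ofReal (∑ i ∈ Finset.range k, (P i).toReal) = ∑ i ∈ Finset.range k, P i := by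
  rw [← toReal_sum_range, ENNReal.ofReal_toReal]
  exact ((sum_range_le_one P k).trans_lt ENNReal.one_lt_top).ne

theorem isExtremal_rearr {Q : PMF ℕ} {L : ℕ} {ε : ℝ} (h : topSum Q L = 1 - ε) :
    IsExtremal Q L ε (rearr Q) where
  antitone := rearr_antitone Q
  sum_eq := by rw [← h, topSum, ofReal_sum_toReal]
  majorized := fun _ _ hR _ => hR

theorem Shape.isExtremal {Q : PMF ℕ} {L j : ℕ} {ε v w : ℝ} {K : ℕ∞}
    (h : Shape Q L (1 - ε) j K v w) : IsExtremal Q L ε h.toPMF where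
  antitone := h.toPMF_antitone
  sum_eq := by
    rw [← ofReal_sum_toReal]
    simp only [h.toReal_toPMF]
    rw [h.sum_of_le_L h.j_lt.le le_rfl, h.v_eq]
  majorized := by
    intro R hR hQ hL k
    rw [← ofReal_sum_toReal, ← ofReal_sum_toReal]
    refine ENNReal.ofReal_le_ofReal ?_
    simp only [h.toReal_toPMF]
    refine h.sum_le (fun x y hxy => ENNReal.toReal_mono (apply_ne_top _ _) (hR hxy))
      (fun i => ENNReal.toReal_nonneg) (fun k => ?_) ?_ k
    · rw [topSum, ← toReal_sum_range, ← toReal_sum_range]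
      exact ENNReal.toReal_mono ((sum_range_le_one R k).trans_lt ENNReal.one_lt_top).ne (hQ k)
    · rw [← ofReal_sum_toReal] at hL
      exact (ENNReal.ofReal_le_ofReal_iff (Finset.sum_nonneg fun i _ => ENNReal.toReal_nonneg)).1 hL

theorem nonneg_of_inRange {Q : PMF ℕ} {L : ℕ} {ε : ℝ} {𝒴 : Type u} (h : InRange Q L ε 𝒴) :
    0 ≤ ε := by
  refine le_trans ?_ h.1
  rw [sub_nonneg]
  have hs := hasSum_toReal (rearr Q)
  rw [← hs.tsum_eq]
  have hle : ∀ i, (if ((i + 1 : ℕ) : ℕ∞) ≤ ENat.card 𝒴 * L then q Q (i + 1) else 0)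
      ≤ (rearr Q i).toReal := by
    intro i
    split_ifs
    · exact le_rfl
    · exact ENNReal.toReal_nonneg
  refine Summable.tsum_le_tsum hle (Summable.of_nonneg_of_le (fun i => ?_) hle hs.summable)
    hs.summable
  split_ifs
  · exact ENNReal.toReal_nonneg
  · exact le_rfl

/-- An empty 𝒴 would force ε ≥ 1, whereas the marginal error is less than 1 for `L ≥ 1`. -/
theorem nonempty_of_inRange {Q : PMF ℕ} {L : ℕ} {ε : ℝ} (hL : 1 ≤ L) {𝒴 : Type u}
    (h : InRange Q L ε 𝒴) : Nonempty 𝒴 := by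
  by_contra hemp
  rw [not_nonempty_iff] at hemp
  have h1 : 1 ≤ ε := by simpa [ENat.card_eq_zero_iff_empty 𝒴 |>.2 hemp] using h.1
  have h2 := h.2
  rw [marginalError_eq] at h2
  have h3 := topSum_mono Q hL
  have h4 : 0 < topSum Q 1 := by
    simp only [topSum, Finset.sum_range_one]
    exact ENNReal.toReal_pos (rearr_zero_ne_zero Q) (apply_ne_top _ _)
  linarith

/-- The type-1 Fano distribution exists, is extremal, and either `ε` is the marginal error and it
is the rearrangement of `Q`, or it is given by parameters as in `Shape`. -/
theorem exists_isFanoType1 {Q : PMF ℕ} {L : ℕ} (hL : 1 ≤ L) {ε : ℝ} (h0 : 0 ≤ ε)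
    (h1 : ε ≤ marginalError Q L) :
    ∃ P₁ : PMF ℕ, IsFanoType1 Q L ε P₁ ∧ IsExtremal Q L ε P₁ ∧
      (P₁ = rearr Q ∨ ε < marginalError Q L ∧ ∃ (v w : ℝ)
        (h : Shape Q L (1 - ε) (J Q L ε - 1) (K Q L ε) v w), P₁ = h.toPMF) := by
  rw [marginalError_eq] at h1 ⊢
  have hshift : ∀ P : PMF ℕ, (∀ x, (P x).toReal = fanoMass Q L ε (x + 1)) →
      IsFanoType1 Q L ε P := by
    intro P hP x hx
    obtain ⟨y, rfl⟩ : ∃ y, x = y + 1 := ⟨x - 1, by omega⟩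
    exact hP y
  rcases eq_or_lt_of_le (show topSum Q L ≤ 1 - ε by linarith) with h | h
  · exact ⟨rearr Q, hshift _ fun x => (fanoMass_of_eq hL h x).symm, isExtremal_rearr h, Or.inl rfl⟩
  · have hs := shape_of_lt hL h0 h
    refine ⟨hs.toPMF, hshift _ fun x => ?_, hs.isExtremal,
      Or.inr ⟨by linarith, _, _, hs, rfl⟩⟩
    rw [hs.toReal_toPMF, fanoMass_eq_shapeMass hL]

/-! ### Random variables -/

/-! ### Measurability of rearrangements and of most likely lists -/

section Measurability

variable {Ω : Type*} [MeasurableSpace Ω]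

/-- There are only countably many finite sets to test for inclusion. The superlevel sets of `rearr`
and membership in `topFinset` are both conditions of this kind. -/
theorem measurableSet_le_encard {E : Ω → Set ℕ} (hE : ∀ x, MeasurableSet {ω | x ∈ E ω}) (n : ℕ) :
    MeasurableSet {ω | (n : ℕ∞) ≤ (E ω).encard} := by
  have : {ω | (n : ℕ∞) ≤ (E ω).encard}
      = ⋃ s : {s : Finset ℕ // s.card = n}, ⋂ x : {x // x ∈ s.1}, {ω | (x : ℕ) ∈ E ω} := by
    ext ω
    simp only [Set.mem_ofPred_eq, Set.mem_iUnion, Set.mem_iInter]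
    constructor
    · intro h
      obtain ⟨s, hs, hcard⟩ := Set.exists_subset_encard_eq h
      have hfin : s.Finite := Set.finite_of_encard_eq_coe hcard
      refine ⟨⟨hfin.toFinset, ?_⟩, fun x => hs (hfin.mem_toFinset.1 x.2)⟩
      rw [hfin.encard_eq_coe_toFinset_card] at hcard
      exact_mod_cast hcard
    · rintro ⟨⟨s, hs⟩, h⟩
      rw [← hs, ← Set.encard_coe_eq_coe_finsetCard]
      exact Set.encard_le_encard fun x hx => h ⟨x, hx⟩
  rw [this]
  exact MeasurableSet.iUnion fun s => MeasurableSet.iInter fun x => hE x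

theorem measurable_rearr {P : Ω → PMF ℕ} (hP : ∀ x, Measurable fun ω => P ω x) (n : ℕ) :
    Measurable fun ω => rearr (P ω) n := by
  refine measurable_of_Ioi fun t => ?_
  have : (fun ω => rearr (P ω) n) ⁻¹' Set.Ioi t
      = {ω | ((n + 1 : ℕ) : ℕ∞) ≤ {x | t < P ω x}.encard} := by
    ext ω
    refine (lt_rearrFun_iff (P ω) n t).trans ?_
    rw [Set.mem_ofPred_eq, Nat.cast_add, Nat.cast_one,
      ENat.add_one_le_iff (ENat.natCast_ne_top n)]
  rw [this]
  exact measurableSet_le_encard (fun x => measurableSet_lt measurable_const (hP x)) _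

theorem measurableSet_mem_topFinset {P : Ω → PMF ℕ} (hP : ∀ x, Measurable fun ω => P ω x)
    (L x : ℕ) : MeasurableSet {ω | x ∈ topFinset (P ω) L} := by
  have : {ω | x ∈ topFinset (P ω) L}
      = {ω | P ω x = 0}ᶜ ∩ {ω | (L : ℕ∞) ≤ (precede (P ω) x).encard}ᶜ := by
    ext ω
    simp [topFinset, topSet]
  rw [this]
  refine (measurableSet_eq_fun (hP x) measurable_const).compl.inter
    (measurableSet_le_encard (fun y => ?_) L).compl
  have : {ω | y ∈ precede (P ω) x} = {ω | P ω x < P ω y} ∪ ({ω | P ω y = P ω x} ∩ {_ω | y < x}) := by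
    ext ω
    rfl
  rw [this]
  exact (measurableSet_lt (hP x) (hP y)).union
    ((measurableSet_eq_fun (hP y) (hP x)).inter (MeasurableSet.const _))

end Measurability

/-! ### The mean rearranged posterior and the Fano-type inequality -/

section RandomVariables

variable {Ω : Type v} {𝒴 : Type u} [MeasurableSpace Ω] [MeasurableSpace 𝒴]

theorem condPMF_apply (X : Ω → ℕ) (Y : Ω → 𝒴) (μ : Measure Ω) [IsFiniteMeasure μ] (y : 𝒴) (x : ℕ) :
    condPMF X Y μ y x = condDistrib X Y μ y {x} := by
  rw [condPMF, Measure.toPMF_apply]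

theorem measurable_condPMF (X : Ω → ℕ) (Y : Ω → 𝒴) (μ : Measure Ω) [IsFiniteMeasure μ] (x : ℕ) :
    Measurable fun y => condPMF X Y μ y x := by
  simp only [condPMF_apply]
  exact Kernel.measurable_coe _ (measurableSet_singleton x)

/-- The probability that `X` is in the list `f Y`, through the conditional distribution. -/
theorem measure_mem_list {X : Ω → ℕ} {Y : Ω → 𝒴} {μ : Measure Ω} [IsFiniteMeasure μ]
    (hX : Measurable X) (hY : Measurable Y) {f : 𝒴 → Finset ℕ}
    (hf : ∀ x, MeasurableSet {y | x ∈ f y}) :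
    μ {ω | X ω ∈ f (Y ω)} = ∫⁻ ω, ∑ x ∈ f (Y ω), condPMF X Y μ (Y ω) x ∂μ := by
  classical
  have hset : {ω | X ω ∈ f (Y ω)} = ⋃ x, (Y ⁻¹' {y | x ∈ f y} ∩ X ⁻¹' {x}) := by
    ext ω
    simp
  have hdisj : Pairwise (Function.onFun Disjoint fun x => Y ⁻¹' {y | x ∈ f y} ∩ X ⁻¹' {x}) :=
    fun a b hab => Set.disjoint_left.2 fun ω h1 h2 => hab (h1.2.symm.trans h2.2)
  rw [hset, measure_iUnion hdisj
    fun x => (hY (hf x)).inter (hX (measurableSet_singleton x))]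
  have hterm : ∀ x, μ (Y ⁻¹' {y | x ∈ f y} ∩ X ⁻¹' {x})
      = ∫⁻ ω, (Y ⁻¹' {y | x ∈ f y}).indicator (fun ω => condPMF X Y μ (Y ω) x) ω ∂μ := by
    intro x
    rw [lintegral_indicator (hY (hf x)), ← setLIntegral_preimage_condDistrib hY hX.aemeasurable
      (measurableSet_singleton x) (hf x)]
    simp only [condPMF_apply]
  simp only [hterm]
  have hmeas : ∀ x, Measurable
      ((Y ⁻¹' {y | x ∈ f y}).indicator fun ω => condPMF X Y μ (Y ω) x) := fun x =>
    ((measurable_condPMF X Y μ x).comp hY).indicator (hY (hf x))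
  rw [← lintegral_tsum fun x => (hmeas x).aemeasurable]
  refine lintegral_congr fun ω => ?_
  rw [tsum_eq_sum (s := f (Y ω))]
  · exact Finset.sum_congr rfl fun x hx => Set.indicator_of_mem (by exact hx) _
  · intro x hx
    exact Set.indicator_of_notMem (by exact hx) _

/-- The mean of the rearranged conditional distributions. -/
def meanRearr (X : Ω → ℕ) (Y : Ω → 𝒴) (μ : Measure Ω) [IsProbabilityMeasure μ]
    (hY : Measurable Y) : PMF ℕ :=
  bary μ (fun ω => rearr (condPMF X Y μ (Y ω))) fun n =>
    measurable_rearr (fun x => (measurable_condPMF X Y μ x).comp hY) n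

theorem sum_meanRearr (X : Ω → ℕ) {Y : Ω → 𝒴} (μ : Measure Ω) [IsProbabilityMeasure μ]
    (hY : Measurable Y) (k : ℕ) : ∑ i ∈ Finset.range k, meanRearr X Y μ hY i
      = ∫⁻ ω, ∑ i ∈ Finset.range k, rearr (condPMF X Y μ (Y ω)) i ∂μ :=
  (lintegral_finsetSum _ fun n _ =>
    measurable_rearr (fun x => (measurable_condPMF X Y μ x).comp hY) n).symm

theorem meanRearr_antitone (X : Ω → ℕ) {Y : Ω → 𝒴} (μ : Measure Ω) [IsProbabilityMeasure μ]
    (hY : Measurable Y) : Antitone (meanRearr X Y μ hY) := fun _ _ h =>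
  lintegral_mono fun ω => rearr_antitone (condPMF X Y μ (Y ω)) h

/-- Used twice: a constant list gives majorization of the law of `X`, and an arbitrary decoder gives
the constraint from the list error. -/
theorem measure_mem_list_le {X : Ω → ℕ} {Y : Ω → 𝒴} {μ : Measure Ω} [IsProbabilityMeasure μ]
    (hX : Measurable X) (hY : Measurable Y) {k : ℕ} {f : 𝒴 → Finset ℕ}
    (hf : ∀ x, MeasurableSet {y | x ∈ f y}) (hk : ∀ y, (f y).card ≤ k) :
    μ {ω | X ω ∈ f (Y ω)} ≤ ∑ i ∈ Finset.range k, meanRearr X Y μ hY i := by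
  rw [measure_mem_list hX hY hf, sum_meanRearr]
  exact lintegral_mono fun ω => (sum_le_sum_rearr _ _).trans
    (Finset.sum_le_sum_of_subset (Finset.range_subset_range.2 (hk _)))

theorem toMeasure_finset (Q : PMF ℕ) (s : Finset ℕ) : Q.toMeasure s = ∑ x ∈ s, Q x :=
  Q.toMeasure_apply_finset s

/-- The mean of the rearranged conditional distributions majorizes the law of `X`. -/
theorem sum_rearr_le_meanRearr {X : Ω → ℕ} {Y : Ω → 𝒴} {μ : Measure Ω} [IsProbabilityMeasure μ]
    (hX : Measurable X) (hY : Measurable Y) {Q : PMF ℕ} (hQ : μ.map X = Q.toMeasure) (k : ℕ) :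
    ∑ i ∈ Finset.range k, rearr Q i ≤ ∑ i ∈ Finset.range k, meanRearr X Y μ hY i := by
  rw [← sum_topFinset, ← toMeasure_finset, ← hQ,
    Measure.map_apply hX (Finset.measurableSet _)]
  -- The decoder ignores `Y` and always lists the `k` most likely symbols under `Q`.
  exact measure_mem_list_le hX hY (f := fun _ => topFinset Q k) (fun _ => MeasurableSet.const _)
    fun _ => card_topFinset_le Q k

theorem measurableSet_mem_list {X : Ω → ℕ} {Y : Ω → 𝒴} (hX : Measurable X) (hY : Measurable Y)
    {f : 𝒴 → Finset ℕ} (hf : ∀ x, MeasurableSet {y | x ∈ f y}) :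
    MeasurableSet {ω | X ω ∈ f (Y ω)} := by
  have hset : {ω | X ω ∈ f (Y ω)} = ⋃ x, (Y ⁻¹' {y | x ∈ f y} ∩ X ⁻¹' {x}) := by
    ext ω
    simp
  rw [hset]
  exact MeasurableSet.iUnion fun x => (hY (hf x)).inter (hX (measurableSet_singleton x))

theorem one_sub_le_sum_meanRearr {X : Ω → ℕ} {Y : Ω → 𝒴} {μ : Measure Ω} [IsProbabilityMeasure μ]
    (hX : Measurable X) (hY : Measurable Y) {L : ℕ} {ε : ℝ} (hε : 0 ≤ ε)
    (h : listError L X Y μ ≤ ENNReal.ofReal ε) :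
    ENNReal.ofReal (1 - ε) ≤ ∑ i ∈ Finset.range L, meanRearr X Y μ hY i := by
  rw [ENNReal.ofReal_sub _ hε, ENNReal.ofReal_one, tsub_le_iff_tsub_le]
  refine le_trans ?_ h
  refine le_iInf₂ fun f hf => ?_
  have hc : {ω | X ω ∉ f (Y ω)} = {ω | X ω ∈ f (Y ω)}ᶜ := rfl
  rw [hc, prob_compl_eq_one_sub (measurableSet_mem_list hX hY hf.2)]
  exact tsub_le_tsub_left (measure_mem_list_le hX hY hf.2 fun y => (hf.1 y).2) _

section Inequality

variable {Q : PMF ℕ} {L : ℕ} {ε : ℝ} {P₁ : PMF ℕ} {X : Ω → ℕ} {Y : Ω → 𝒴}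
  {μ : Measure Ω} [IsProbabilityMeasure μ]

theorem IsExtremal.sum_le_meanRearr (hP₁ : IsExtremal Q L ε P₁) (hε : 0 ≤ ε)
    (hXY : Feasible Q L ε X Y μ) (k : ℕ) :
    ∑ i ∈ Finset.range k, P₁ i ≤ ∑ i ∈ Finset.range k, meanRearr X Y μ hXY.2.1 i :=
  hP₁.majorized _ (meanRearr_antitone X μ hXY.2.1)
    (sum_rearr_le_meanRearr hXY.1 hXY.2.1 hXY.2.2.1)
    (one_sub_le_sum_meanRearr hXY.1 hXY.2.1 hε hXY.2.2.2) k

theorem condInfo_eq_rearr {φ : PMF ℕ → ℝ≥0∞} (hs : IsSymmetric φ) :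
    condInfo φ X Y μ = ∫⁻ ω, φ (rearr (condPMF X Y μ (Y ω))) ∂μ :=
  lintegral_congr fun _ => hs _

theorem condInfo_le_meanRearr {φ : PMF ℕ → ℝ≥0∞} (hs : IsSymmetric φ) (hc : IsConcave φ)
    (hl : IsLSC φ) (hY : Measurable Y) : condInfo φ X Y μ ≤ φ (meanRearr X Y μ hY) := by
  rw [condInfo_eq_rearr hs]
  exact lintegral_le_bary hc hl μ _ _

/-- The Fano-type inequality. -/
theorem IsExtremal.condInfo_le (hP₁ : IsExtremal Q L ε P₁) (hε : 0 ≤ ε) {φ : PMF ℕ → ℝ≥0∞}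
    (hs : IsSymmetric φ) (hc : IsConcave φ) (hl : IsLSC φ) (hXY : Feasible Q L ε X Y μ) :
    condInfo φ X Y μ ≤ φ P₁ :=
  (condInfo_le_meanRearr hs hc hl hXY.2.1).trans
    (le_of_majorize hs hc hl hP₁.antitone _ (hP₁.sum_le_meanRearr hε hXY))

/-- Equality in the Fano-type inequality for strictly concave functions. -/
theorem IsExtremal.isSharp (hP₁ : IsExtremal Q L ε P₁) (hε : 0 ≤ ε) {φ : PMF ℕ → ℝ≥0∞}
    (hs : IsSymmetric φ) (hc : IsConcave φ) (hl : IsLSC φ) (hst : IsStrict φ) (hfin : φ P₁ ≠ ∞)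
    (hXY : Feasible Q L ε X Y μ) (heq : condInfo φ X Y μ = φ P₁) : IsSharp P₁ X Y μ := by
  have hmaj := hP₁.sum_le_meanRearr hε hXY
  have h1 := condInfo_le_meanRearr (X := X) (μ := μ) hs hc hl hXY.2.1
  -- The two inequalities from `condInfo` to `φ P₁` collapse: equality in Schur concavity identifies
  -- the mean with `P₁`, and equality in Jensen's inequality then makes the rearranged posterior
  -- constant.
  have hR : meanRearr X Y μ hXY.2.1 = P₁ :=
    eq_of_majorize hs hc hl hst hP₁.antitone _ hmaj hfin (heq ▸ h1)
  intro x
  have h2 := ae_eq_bary hc hl hst μ (fun ω => rearr (condPMF X Y μ (Y ω)))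
    (fun n => measurable_rearr (fun x => (measurable_condPMF X Y μ x).comp hXY.2.1) n)
    (by change φ (meanRearr X Y μ hXY.2.1) ≠ ∞; rwa [hR])
    (by
      change φ (meanRearr X Y μ hXY.2.1) ≤ _
      rw [hR, ← condInfo_eq_rearr hs, heq]) x
  change ∀ᵐ ω ∂μ, rearr (condPMF X Y μ (Y ω)) x = meanRearr X Y μ hXY.2.1 x at h2
  rwa [hR] at h2

theorem IsSharp.ae_eq (h : IsSharp P₁ X Y μ) : ∀ᵐ ω ∂μ, rearr (condPMF X Y μ (Y ω)) = P₁ := by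
  filter_upwards [ae_all_iff.2 h] with ω hω
  exact PMF.ext hω

theorem IsSharp.condInfo_eq (h : IsSharp P₁ X Y μ) {φ : PMF ℕ → ℝ≥0∞} (hs : IsSymmetric φ) :
    condInfo φ X Y μ = φ P₁ := by
  rw [condInfo_eq_rearr hs]
  have : ∀ᵐ ω ∂μ, φ (rearr (condPMF X Y μ (Y ω))) = φ P₁ := h.ae_eq.mono fun ω hω => by rw [hω]
  rw [lintegral_congr_ae this]
  simp

/-- Listing the `L` most likely symbols of the posterior succeeds with probability equal to the sum
of the `L` largest masses of `P₁`, which is `1 - ε`. -/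
theorem IsExtremal.feasible_of_isSharp (hP₁ : IsExtremal Q L ε P₁) (hL : 1 ≤ L) (hε : ε ≤ 1)
    (hX : Measurable X) (hY : Measurable Y) (hQ : μ.map X = Q.toMeasure)
    (h : IsSharp P₁ X Y μ) : Feasible Q L ε X Y μ := by
  refine ⟨hX, hY, hQ, ?_⟩
  have hf : ∀ x, MeasurableSet {y | x ∈ topFinset (condPMF X Y μ y) L} :=
    measurableSet_mem_topFinset (measurable_condPMF X Y μ) L
  refine (iInf₂_le (fun y => topFinset (condPMF X Y μ y) L) ⟨fun y =>
    ⟨one_le_card_topFinset _ hL, card_topFinset_le _ _⟩, hf⟩).trans ?_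
  have hc : {ω | X ω ∉ topFinset (condPMF X Y μ (Y ω)) L}
      = {ω | X ω ∈ topFinset (condPMF X Y μ (Y ω)) L}ᶜ := rfl
  rw [hc, prob_compl_eq_one_sub (measurableSet_mem_list hX hY hf), measure_mem_list hX hY hf]
  have : ∀ᵐ ω ∂μ, ∑ x ∈ topFinset (condPMF X Y μ (Y ω)) L, condPMF X Y μ (Y ω) x
      = ENNReal.ofReal (1 - ε) := by
    filter_upwards [h.ae_eq] with ω hω
    rw [sum_topFinset, hω, hP₁.sum_eq]
  rw [lintegral_congr_ae this, lintegral_const, measure_univ, mul_one, ← ENNReal.ofReal_one,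
    ← ENNReal.ofReal_sub _ (by linarith)]
  simp

end Inequality

end RandomVariables

/-! ### From mixtures of arrangements of P₁ to lower bounds on the supremum -/

/-- The Markov kernel given by a measurable family of distributions. -/
def kernelOfPMF {𝒴 : Type u} [MeasurableSpace 𝒴] (κ : 𝒴 → PMF ℕ)
    (hκ : ∀ x, Measurable fun y => κ y x) : Kernel 𝒴 ℕ where
  toFun y := (κ y).toMeasure
  measurable' := by
    refine Measure.measurable_of_measurable_coe _ fun s hs => ?_
    simp only [PMF.toMeasure_apply _ hs]
    refine Measurable.tsum fun x => ?_
    by_cases hx : x ∈ s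
    · simpa [hx] using hκ x
    · simp [hx]

theorem kernelOfPMF_apply {𝒴 : Type u} [MeasurableSpace 𝒴] (κ : 𝒴 → PMF ℕ)
    (hκ : ∀ x, Measurable fun y => κ y x) (y : 𝒴) : kernelOfPMF κ hκ y = (κ y).toMeasure := rfl

instance {𝒴 : Type u} [MeasurableSpace 𝒴] (κ : 𝒴 → PMF ℕ) (hκ : ∀ x, Measurable fun y => κ y x) :
    IsMarkovKernel (kernelOfPMF κ hκ) :=
  ⟨fun y => by rw [kernelOfPMF_apply]; infer_instance⟩

/-- If `Q` is a mixture of distributions whose rearrangement is `P₁`, indexed by `𝒴`, then the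
supremum is at least `φ P₁`. -/
theorem IsExtremal.le_supInfo {Q : PMF ℕ} {L : ℕ} {ε : ℝ} {P₁ : PMF ℕ}
    (hP₁ : IsExtremal Q L ε P₁) (hL : 1 ≤ L) (hε : ε ≤ 1) {φ : PMF ℕ → ℝ≥0∞} (hs : IsSymmetric φ)
    {𝒴 : Type u} [MeasurableSpace 𝒴] (ν : Measure 𝒴) [IsProbabilityMeasure ν] (κ : 𝒴 → PMF ℕ)
    (hκ : ∀ x, Measurable fun y => κ y x) (hQ : ∀ x, ∫⁻ y, κ y x ∂ν = Q x)
    (hsharp : ∀ᵐ y ∂ν, rearr (κ y) = P₁) : φ P₁ ≤ supInfo φ Q L ε 𝒴 := by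
  set k := kernelOfPMF κ hκ with hk
  -- The pair of coordinates under this joint law has marginals `ν` and `Q` and posterior `κ` almost
  -- everywhere.
  set μ : Measure (𝒴 × ℕ) := ν ⊗ₘ k with hμ
  have hfst : μ.map Prod.fst = ν := Measure.fst_compProd ν k
  have hsnd : μ.map Prod.snd = Q.toMeasure := by
    refine Measure.ext_of_singleton fun x => ?_
    rw [PMF.toMeasure_apply_singleton _ _ (measurableSet_singleton x), ← hQ x,
      Measure.map_apply measurable_snd (measurableSet_singleton x),
      Measure.compProd_apply (measurable_snd (measurableSet_singleton x))]
    refine lintegral_congr fun y => ?_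
    rw [hk, kernelOfPMF_apply]
    exact PMF.toMeasure_apply_singleton _ _ (measurableSet_singleton x)
  have hae : ∀ᵐ y ∂ν, condDistrib Prod.snd Prod.fst μ y = k y := by
    have := condDistrib_ae_eq_of_measure_eq_compProd (μ := μ) (Prod.fst : 𝒴 × ℕ → 𝒴)
      (Y := Prod.snd) (κ := k) measurable_snd.aemeasurable (by
        rw [hfst]
        exact Measure.map_id)
    rwa [hfst] at this
  have hS : IsSharp P₁ (Prod.snd : 𝒴 × ℕ → ℕ) Prod.fst μ := by
    intro x
    have h1 : ∀ᵐ y ∂(μ.map Prod.fst), rearr (condPMF Prod.snd Prod.fst μ y) x = P₁ x := by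
      rw [hfst]
      filter_upwards [hae, hsharp] with y hy hy'
      rw [← hy']
      congr 2
      ext z
      rw [condPMF_apply, hy, hk, kernelOfPMF_apply]
      exact PMF.toMeasure_apply_singleton _ _ (measurableSet_singleton z)
    exact ae_of_ae_map measurable_fst.aemeasurable h1
  rw [← hS.condInfo_eq hs]
  exact le_sSup ⟨𝒴 × ℕ, inferInstance, μ, inferInstance, Prod.snd, Prod.fst,
    hP₁.feasible_of_isSharp hL hε measurable_snd measurable_fst hsnd hS, rfl⟩

theorem IsExtremal.supInfo_le {Q : PMF ℕ} {L : ℕ} {ε : ℝ} {P₁ : PMF ℕ}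
    (hP₁ : IsExtremal Q L ε P₁) (hε : 0 ≤ ε) {φ : PMF ℕ → ℝ≥0∞} (hs : IsSymmetric φ)
    (hc : IsConcave φ) (hl : IsLSC φ) (𝒴 : Type u) [MeasurableSpace 𝒴] :
    supInfo φ Q L ε 𝒴 ≤ φ P₁ := by
  refine sSup_le ?_
  rintro _ ⟨Ω, _, μ, _, X, Y, hXY, rfl⟩
  exact hP₁.condInfo_le hε hs hc hl hXY

/-- The given `Ω` may live in another universe than those in `supInfo`, so the pair is rebuilt on `𝒴
× ℕ` from the law of `Y` and the posterior. -/
theorem IsExtremal.le_supInfo_of_isSharp {Q : PMF ℕ} {L : ℕ} {ε : ℝ} {P₁ : PMF ℕ}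
    (hP₁ : IsExtremal Q L ε P₁) (hL : 1 ≤ L) (hε : ε ≤ 1) {φ : PMF ℕ → ℝ≥0∞} (hs : IsSymmetric φ)
    {Ω : Type v} {𝒴 : Type u} [MeasurableSpace Ω] [MeasurableSpace 𝒴] {μ : Measure Ω}
    [IsProbabilityMeasure μ] {X : Ω → ℕ} {Y : Ω → 𝒴} (hX : Measurable X) (hY : Measurable Y)
    (hQ : μ.map X = Q.toMeasure) (h : IsSharp P₁ X Y μ) : φ P₁ ≤ supInfo φ Q L ε 𝒴 := by
  have := Measure.isProbabilityMeasure_map (μ := μ) hY.aemeasurable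
  refine hP₁.le_supInfo hL hε hs (μ.map Y) (condPMF X Y μ) (measurable_condPMF X Y μ)
    (fun x => ?_) ?_
  · rw [lintegral_map (measurable_condPMF X Y μ x) hY]
    have h1 := measure_mem_list (μ := μ) hX hY (f := fun _ => {x}) fun _ => MeasurableSet.const _
    simp only [Finset.sum_singleton, Finset.mem_singleton] at h1
    rw [← h1, ← PMF.toMeasure_apply_singleton Q x (measurableSet_singleton x), ← hQ,
      Measure.map_apply hX (measurableSet_singleton x)]
    rfl
  · have hall : ∀ x, ∀ᵐ y ∂(μ.map Y), rearr (condPMF X Y μ y) x = P₁ x := fun x =>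
      (ae_map_iff hY.aemeasurable (measurableSet_eq_fun
        (measurable_rearr (measurable_condPMF X Y μ) x) measurable_const)).2 (h x)
    filter_upwards [ae_all_iff.2 hall] with y hy
    exact PMF.ext hy

/-! ### Systematic sampling

For inclusion probabilities `p 0, p 1, …` in `[0, 1]` with integral sum `m`, lay out intervals of
lengths `p 0, p 1, …` one after the other.  The sample for `t ∈ [0, 1)` consists of the intervals
that meet `t + ℤ`; it has `m` elements, and for uniform `t` the inclusion probabilities are `p`. -/

/-- Dependence on `t` is reduced to a single threshold, the fractional part of `b`; both the
inclusion probabilities and the count of distinct samples rest on this. -/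
theorem ceil_sub_eq {b t : ℝ} (ht : t ∈ Set.Ico (0 : ℝ) 1) :
    ⌈b - t⌉ = ⌊b⌋ + if t < Int.fract b then 1 else 0 := by
  have h1 := Int.floor_add_fract b
  have h2 := Int.fract_nonneg b
  have h3 := Int.fract_lt_one b
  obtain ⟨h4, h5⟩ := ht
  rw [Int.ceil_eq_iff]
  split_ifs with h
  · push_cast; constructor <;> linarith
  · push_cast; constructor <;> linarith

/-- The set of intervals that meet `t + ℤ`. -/
def sampleSet (p : ℕ → ℝ) (t : ℝ) : Set ℕ :=
  {x | ⌈∑ i ∈ Finset.range x, p i - t⌉ < ⌈∑ i ∈ Finset.range (x + 1), p i - t⌉}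

theorem measurableSet_mem_sampleSet (p : ℕ → ℝ) (x : ℕ) :
    MeasurableSet {t | x ∈ sampleSet p t} :=
  measurableSet_lt (Int.measurable_ceil.comp (measurable_const.sub measurable_id))
    (Int.measurable_ceil.comp (measurable_const.sub measurable_id))

open Classical in
/-- The systematic sample. -/
def sample (p : ℕ → ℝ) (t : ℝ) : Finset ℕ :=
  if h : (sampleSet p t).Finite then h.toFinset else ∅

section Sampling

variable {p : ℕ → ℝ} {m : ℕ}

theorem ceil_succ_eq (h0 : ∀ x, 0 ≤ p x) (h1 : ∀ x, p x ≤ 1) (t : ℝ) (x : ℕ)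
    [Decidable (x ∈ sampleSet p t)] :
    ⌈∑ i ∈ Finset.range (x + 1), p i - t⌉
      = ⌈∑ i ∈ Finset.range x, p i - t⌉ + if x ∈ sampleSet p t then 1 else 0 := by
  have hle : ⌈∑ i ∈ Finset.range x, p i - t⌉ ≤ ⌈∑ i ∈ Finset.range (x + 1), p i - t⌉ := by
    refine Int.ceil_le_ceil ?_
    rw [Finset.sum_range_succ]
    linarith [h0 x]
  have hle' : ⌈∑ i ∈ Finset.range (x + 1), p i - t⌉ ≤ ⌈∑ i ∈ Finset.range x, p i - t⌉ + 1 := by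
    rw [← Int.ceil_add_one]
    refine Int.ceil_le_ceil ?_
    rw [Finset.sum_range_succ]
    linarith [h1 x]
  have hiff : x ∈ sampleSet p t ↔
    ⌈∑ i ∈ Finset.range x, p i - t⌉ < ⌈∑ i ∈ Finset.range (x + 1), p i - t⌉ := Iff.rfl
  split_ifs with h <;> rw [hiff] at h <;> omega

/-- An interval of length at most one raises the ceiling by at most one, so the ceiling at `x`
counts the sampled indices below `x`. It starts at ⌈-t⌉ = 0 and is `m` once the partial sums exceed
`m - 1 + t`. -/
theorem sampleSet_finite_card (h0 : ∀ x, 0 ≤ p x) (h1 : ∀ x, p x ≤ 1) (hs : HasSum p m) {t : ℝ}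
    (ht : t ∈ Set.Ico (0 : ℝ) 1) : ∃ s : Finset ℕ, sampleSet p t = s ∧ s.card = m := by
  classical
  have hmono : Monotone fun x => ∑ i ∈ Finset.range x, p i := fun a b hab =>
    Finset.sum_le_sum_of_subset_of_nonneg (Finset.range_subset_range.2 hab) fun i _ _ => h0 i
  have hle : ∀ x, ∑ i ∈ Finset.range x, p i ≤ m := fun x =>
    hmono.ge_of_tendsto hs.tendsto_sum_nat x
  obtain ⟨M, hM⟩ := (hs.tendsto_sum_nat.eventually
    (lt_mem_nhds (show (m : ℝ) - 1 + t < m by linarith [ht.2]))).exists_forall_of_atTop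
  have hN : ∀ x, M ≤ x → ⌈∑ i ∈ Finset.range x, p i - t⌉ = m := by
    intro x hx
    rw [Int.ceil_eq_iff]
    have := hM x hx
    have := hle x
    have := ht.1
    push_cast
    constructor <;> linarith
  have hcount : ∀ x, ⌈∑ i ∈ Finset.range x, p i - t⌉
      = (((Finset.range x).filter fun i => i ∈ sampleSet p t).card : ℤ) := by
    intro x
    induction x with
    | zero =>
      simp only [Finset.range_zero, Finset.sum_empty, zero_sub, Finset.filter_empty,
        Finset.card_empty, Nat.cast_zero]
      rw [Int.ceil_eq_iff]
      push_cast
      constructor <;> linarith [ht.1, ht.2]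
    | succ x ih =>
      rw [ceil_succ_eq h0 h1, ih, Finset.range_add_one, Finset.filter_insert]
      split_ifs
      · rw [Finset.card_insert_of_notMem (by simp)]; push_cast; ring
      · simp
  refine ⟨(Finset.range M).filter fun i => i ∈ sampleSet p t, ?_, ?_⟩
  · ext x
    simp only [Finset.coe_filter, Finset.mem_range, Set.mem_ofPred_eq, iff_and_self]
    intro hx
    by_contra hxM
    have hx' : ⌈∑ i ∈ Finset.range x, p i - t⌉ < ⌈∑ i ∈ Finset.range (x + 1), p i - t⌉ := hx
    rw [hN x (by omega), hN (x + 1) (by omega)] at hx'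
    exact lt_irrefl _ hx'
  · have := hcount M
    rw [hN M le_rfl] at this
    exact_mod_cast this.symm

theorem mem_sample (h0 : ∀ x, 0 ≤ p x) (h1 : ∀ x, p x ≤ 1) (hs : HasSum p m) {t : ℝ}
    (ht : t ∈ Set.Ico (0 : ℝ) 1) {x : ℕ} : x ∈ sample p t ↔ x ∈ sampleSet p t := by
  obtain ⟨s, hs', -⟩ := sampleSet_finite_card h0 h1 hs ht
  have hfin : (sampleSet p t).Finite := hs' ▸ s.finite_toSet
  rw [sample, dif_pos hfin, Set.Finite.mem_toFinset]

theorem card_sample (h0 : ∀ x, 0 ≤ p x) (h1 : ∀ x, p x ≤ 1) (hs : HasSum p m) {t : ℝ}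
    (ht : t ∈ Set.Ico (0 : ℝ) 1) : (sample p t).card = m := by
  obtain ⟨s, hs', hc⟩ := sampleSet_finite_card h0 h1 hs ht
  have : sample p t = s := by
    ext x
    rw [mem_sample h0 h1 hs ht, hs', Finset.mem_coe]
  rw [this, hc]

theorem ne_zero_of_mem_sampleSet {t : ℝ} {x : ℕ} (hx : x ∈ sampleSet p t) : p x ≠ 0 := by
  intro h
  have hx' : ⌈∑ i ∈ Finset.range x, p i - t⌉ < ⌈∑ i ∈ Finset.range (x + 1), p i - t⌉ := hx
  rw [Finset.sum_range_succ, h, add_zero] at hx'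
  exact hx'.false

/-- The uniform distribution on `[0, 1)`. -/
def unif : Measure ℝ := volume.restrict (Set.Ico 0 1)

instance : IsProbabilityMeasure unif := ⟨by simp [unif]⟩

theorem ae_unif_mem : ∀ᵐ t ∂unif, t ∈ Set.Ico (0 : ℝ) 1 := ae_restrict_mem measurableSet_Ico

theorem integral_indicator_Iio {f : ℝ} (h0 : 0 ≤ f) (h1 : f < 1) :
    Integrable (fun t => if t < f then (1 : ℝ) else 0) unif ∧
      ∫ t, (if t < f then (1 : ℝ) else 0) ∂unif = f := by
  have heq : (fun t => if t < f then (1 : ℝ) else 0) = (Set.Iio f).indicator 1 := by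
    ext t
    simp [Set.indicator_apply]
  rw [heq]
  constructor
  · exact (integrable_const (1 : ℝ)).indicator measurableSet_Iio
  · rw [integral_indicator_one measurableSet_Iio, measureReal_def, unif,
      Measure.restrict_apply measurableSet_Iio]
    have : Set.Iio f ∩ Set.Ico 0 1 = Set.Ico 0 f := by
      ext t
      simp only [Set.mem_inter_iff, Set.mem_Iio, Set.mem_Ico]
      constructor
      · rintro ⟨a, b, c⟩; exact ⟨b, a⟩
      · rintro ⟨a, b⟩; exact ⟨b, a, b.trans h1⟩
    rw [this, Real.volume_Ico, sub_zero, ENNReal.toReal_ofReal h0]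

/-- The inclusion probabilities of the systematic sample. -/
theorem unif_mem_sampleSet (h0 : ∀ x, 0 ≤ p x) (h1 : ∀ x, p x ≤ 1) (x : ℕ) :
    unif {t | x ∈ sampleSet p t} = ENNReal.ofReal (p x) := by
  classical
  set b := ∑ i ∈ Finset.range x, p i with hb
  set d := ∑ i ∈ Finset.range (x + 1), p i with hd
  have hbd : d = b + p x := Finset.sum_range_succ _ _
  rw [← ofReal_measureReal, ← integral_indicator_one (measurableSet_mem_sampleSet p x)]
  congr 1
  -- The indicator is ⌈d - t⌉ - ⌈b - t⌉. Averaging turns each threshold term into a fractional part,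
  -- which leaves d - b = p x.
  have hae : ∀ᵐ t ∂unif, ({t | x ∈ sampleSet p t}.indicator (1 : ℝ → ℝ)) t
      = ((⌊d⌋ : ℝ) - ⌊b⌋) + (if t < Int.fract d then (1 : ℝ) else 0)
        - (if t < Int.fract b then (1 : ℝ) else 0) := by
    filter_upwards [ae_unif_mem] with t ht
    have h := ceil_succ_eq h0 h1 t x
    rw [← hb, ← hd, ceil_sub_eq ht, ceil_sub_eq ht] at h
    have h' : ((⌊d⌋ : ℝ) + if t < Int.fract d then (1 : ℝ) else 0)
        = (⌊b⌋ : ℝ) + (if t < Int.fract b then (1 : ℝ) else 0)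
          + (if x ∈ sampleSet p t then (1 : ℝ) else 0) := by exact_mod_cast h
    have h'' : ({t | x ∈ sampleSet p t}.indicator (1 : ℝ → ℝ)) t
        = if x ∈ sampleSet p t then (1 : ℝ) else 0 := by
      simp [Set.indicator_apply]
    rw [h'']
    linarith
  obtain ⟨hi1, hi2⟩ := integral_indicator_Iio (Int.fract_nonneg d) (Int.fract_lt_one d)
  obtain ⟨hi3, hi4⟩ := integral_indicator_Iio (Int.fract_nonneg b) (Int.fract_lt_one b)
  have hi5 : Integrable (fun t => ((⌊d⌋ : ℝ) - ⌊b⌋) + if t < Int.fract d then (1 : ℝ) else 0) unif :=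
    (integrable_const _).add hi1
  rw [integral_congr_ae hae, integral_sub hi5 hi3,
    integral_add (integrable_const _) hi1, hi2, hi4]
  simp only [integral_const, probReal_univ, smul_eq_mul, one_mul]
  have := Int.floor_add_fract d
  have := Int.floor_add_fract b
  linarith

/-- If `p` vanishes off `[j, k)`, then the sample takes at most `k - j` values. -/
theorem exists_sample_classes {j k : ℕ} (hjk : j < k) (hj : ∀ x < j, p x = 0)
    (hk : ∀ x, k ≤ x → p x = 0) (hs : HasSum p m) :
    ∃ g : ℝ → Fin (k - j), ∀ t ∈ Set.Ico (0 : ℝ) 1, ∀ t' ∈ Set.Ico (0 : ℝ) 1, g t = g t' →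
      sample p t = sample p t' := by
  classical
  -- The thresholds already passed at `t`. These sets form a chain, so each is determined by its
  -- cardinality, which lies between 1 and `k - j` because the threshold at `j` is 0. Outside `[j,
  -- k)` the partial sums are integers and give no further thresholds.
  set D : ℝ → Finset ℕ := fun t => (Finset.Ico j k).filter fun x =>
    Int.fract (∑ i ∈ Finset.range x, p i) ≤ t with hD
  have hCj : ∀ x ≤ j, ∑ i ∈ Finset.range x, p i = 0 := fun x hx =>
    Finset.sum_eq_zero fun i hi => hj i (by have := Finset.mem_range.1 hi; omega)
  have hCk : ∀ x, k ≤ x → ∑ i ∈ Finset.range x, p i = m := by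
    intro x hx
    refine HasSum.unique ?_ hs
    exact hasSum_sum_of_ne_finset_zero fun i hi => hk i (by
      simp only [Finset.mem_range, not_lt] at hi; omega)
  have hmono : ∀ t t', t ≤ t' → D t ⊆ D t' := fun t t' h x hx => by
    simp only [hD, Finset.mem_filter] at hx ⊢
    exact ⟨hx.1, hx.2.trans h⟩
  have hcard : ∀ t, (D t).card ≤ k - j := fun t =>
    (Finset.card_filter_le _ _).trans (by simp)
  have hpos : ∀ t ∈ Set.Ico (0 : ℝ) 1, 0 < (D t).card := fun t ht =>
    Finset.card_pos.2 ⟨j, by simp [hD, hjk, hCj j le_rfl, ht.1]⟩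
  have hdet : ∀ t ∈ Set.Ico (0 : ℝ) 1, ∀ t' ∈ Set.Ico (0 : ℝ) 1, D t = D t' →
      sample p t = sample p t' := by
    intro t ht t' ht' h
    have hceil : ∀ x, ⌈∑ i ∈ Finset.range x, p i - t⌉ = ⌈∑ i ∈ Finset.range x, p i - t'⌉ := by
      intro x
      rw [ceil_sub_eq ht, ceil_sub_eq ht']
      have hiff : t < Int.fract (∑ i ∈ Finset.range x, p i)
          ↔ t' < Int.fract (∑ i ∈ Finset.range x, p i) := by
        by_cases hx : x ∈ Finset.Ico j k
        · have := Finset.ext_iff.1 h x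
          simp only [hD, Finset.mem_filter, hx, true_and] at this
          rw [← not_le, ← not_le, this]
        · have hz : Int.fract (∑ i ∈ Finset.range x, p i) = 0 := by
            simp only [Finset.mem_Ico, not_and, not_lt] at hx
            rcases le_total x j with hxj | hxj
            · rw [hCj x hxj, Int.fract_zero]
            · rw [hCk x (hx hxj), Int.fract_natCast]
          rw [hz]
          exact ⟨fun h => absurd h (not_lt.2 ht.1), fun h => absurd h (not_lt.2 ht'.1)⟩
      simp only [hiff]
    have : sampleSet p t = sampleSet p t' := by
      ext x
      simp only [sampleSet, Set.mem_ofPred_eq, hceil]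
    simp only [sample, this]
  refine ⟨fun t => ⟨(D t).card - 1, by have := hcard t; omega⟩, fun t ht t' ht' h => ?_⟩
  have hc : (D t).card = (D t').card := by
    have h1 := congrArg Fin.val h
    simp only at h1
    have := hpos t ht
    have := hpos t' ht'
    omega
  refine hdet t ht t' ht' ?_
  rcases le_total t t' with hle | hle
  · exact Finset.eq_of_subset_of_card_le (hmono _ _ hle) hc.ge
  · exact (Finset.eq_of_subset_of_card_le (hmono _ _ hle) hc.le).symm

theorem measurable_sample (p : ℕ → ℝ) : Measurable[_, ⊤] (sample p) := by
  classical
  let _ : MeasurableSpace (Finset ℕ) := ⊤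
  refine measurable_to_countable' fun s => ?_
  have hmem : ∀ s : Finset ℕ, MeasurableSet {t | sampleSet p t = s} := by
    intro s
    have : {t | sampleSet p t = s} = ⋂ x, {t | x ∈ sampleSet p t ↔ x ∈ s} := by
      ext t
      simp [Set.ext_iff]
    rw [this]
    refine MeasurableSet.iInter fun x => ?_
    by_cases hx : x ∈ s
    · simpa [hx] using measurableSet_mem_sampleSet p x
    · simp only [hx, iff_false]
      exact (measurableSet_mem_sampleSet p x).compl
  have hfin : MeasurableSet {t | (sampleSet p t).Finite} := by
    have : {t | (sampleSet p t).Finite} = ⋃ s : Finset ℕ, {t | sampleSet p t = s} := by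
      ext t
      simp only [Set.mem_ofPred_eq, Set.mem_iUnion]
      exact ⟨fun h => ⟨h.toFinset, by simp⟩, fun ⟨s, hs⟩ => hs ▸ s.finite_toSet⟩
    rw [this]
    exact MeasurableSet.iUnion hmem
  have : sample p ⁻¹' {s} = {t | sampleSet p t = s} ∪
      ({t | (sampleSet p t).Finite}ᶜ ∩ {_t | s = ∅}) := by
    ext t
    simp only [Set.mem_preimage, Set.mem_singleton_iff, sample, Set.mem_union, Set.mem_inter_iff,
      Set.mem_compl_iff, Set.mem_ofPred_eq]
    by_cases h : (sampleSet p t).Finite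
    · rw [dif_pos h]
      simp only [h, not_true_eq_false, false_and, or_false]
      rw [← Finset.coe_inj, h.coe_toFinset]
    · rw [dif_neg h]
      simp only [h, not_false_eq_true, true_and]
      exact ⟨fun h' => Or.inr h'.symm, fun h' => h'.elim
        (fun h'' => absurd (h'' ▸ s.finite_toSet) h) Eq.symm⟩
  rw [this]
  exact (hmem s).union (hfin.compl.inter (MeasurableSet.const _))

end Sampling

/-! ### Mixtures of arrangements of the Fano distribution -/

/-- Two finite subsets of `A` of the same size are related by a permutation fixing `Aᶜ`. -/
theorem exists_perm_of_card_eq {A : Set ℕ} (T s : Finset ℕ) (hT : ↑T ⊆ A) (hs : ↑s ⊆ A)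
    (hcard : s.card = T.card) :
    ∃ σ : Equiv.Perm ℕ, (∀ x, σ x ∈ T ↔ x ∈ s) ∧ ∀ x, x ∉ A → σ x = x := by
  -- Swap an element of `s \ T` with one of `T \ s`; both lie in `A`.
  induction hn : (s \ T).card generalizing s with
  | zero =>
    have hsub : s ⊆ T := Finset.sdiff_eq_empty_iff_subset.1 (Finset.card_eq_zero.1 hn)
    obtain rfl := Finset.eq_of_subset_of_card_le hsub hcard.ge
    exact ⟨1, fun x => Iff.rfl, fun x _ => rfl⟩
  | succ n ih =>
    have hpos : 0 < (s \ T).card := by omega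
    have hpos' : 0 < (T \ s).card := by rwa [← Finset.card_sdiff_comm hcard]
    obtain ⟨a, ha⟩ := Finset.card_pos.1 hpos
    obtain ⟨b, hb⟩ := Finset.card_pos.1 hpos'
    obtain ⟨has, haT⟩ := Finset.mem_sdiff.1 ha
    obtain ⟨hbT, hbs⟩ := Finset.mem_sdiff.1 hb
    have hab : a ≠ b := fun h => hbs (h ▸ has)
    have hbe : b ∉ s.erase a := fun h => hbs (Finset.mem_of_mem_erase h)
    obtain ⟨σ, h1, h2⟩ := ih (insert b (s.erase a))
      (by
        intro x hx
        rcases Finset.mem_insert.1 (Finset.mem_coe.1 hx) with rfl | hx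
        · exact hT hbT
        · exact hs (Finset.mem_of_mem_erase hx))
      (by rw [Finset.card_insert_of_notMem hbe, Finset.card_erase_add_one has, hcard])
      (by
        have : insert b (s.erase a) \ T = (s \ T).erase a := by
          ext x
          simp only [Finset.mem_sdiff, Finset.mem_insert, Finset.mem_erase]
          constructor
          · rintro ⟨rfl | ⟨h, h'⟩, h''⟩
            · exact absurd hbT h''
            · exact ⟨h, h', h''⟩
          · rintro ⟨h, h', h''⟩
            exact ⟨Or.inr ⟨h, h'⟩, h''⟩
        rw [this, Finset.card_erase_of_mem ha, hn, Nat.add_sub_cancel])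
    refine ⟨(Equiv.swap a b).trans σ, fun x => ?_, fun x hx => ?_⟩
    · rw [Equiv.trans_apply, h1, Finset.mem_insert, Finset.mem_erase]
      by_cases hxa : x = a
      · subst hxa; simp [has]
      by_cases hxb : x = b
      · subst hxb; simp [hbs, hab]
      · rw [Equiv.swap_apply_of_ne_of_ne hxa hxb]; simp [hxa, hxb]
    · rw [Equiv.trans_apply, Equiv.swap_apply_of_ne_of_ne
        (fun h => hx (by rw [h]; exact hs has)) (fun h => hx (by rw [h]; exact hT hbT)), h2 x hx]

/-- Carry a distribution on the ranks of `Q` over to the symbols. -/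
theorem exists_pullback_rank (Q P : PMF ℕ) (h : ∀ n, rearr Q n = 0 → P n = 0) :
    ∃ R : PMF ℕ, (∀ x, Q x ≠ 0 → R x = P (rank Q x)) ∧ (∀ x, Q x = 0 → R x = 0) ∧
      rearr R = rearr P := by
  classical
  -- By `h`, `P` is carried by the ranks of the support of `Q`, where `rank` is injective, so no
  -- mass is lost.
  have hsum : ∑' x, (if Q x ≠ 0 then P (rank Q x) else 0) = 1 := by
    calc ∑' x, (if Q x ≠ 0 then P (rank Q x) else 0)
        = ∑' x : {x | Q x ≠ 0}, P (rank Q x) := by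
          rw [tsum_subtype {x | Q x ≠ 0} fun x => P (rank Q x)]
          refine tsum_congr fun x => ?_
          simp [Set.indicator_apply]
      _ = ∑' n : (rank Q '' {x | Q x ≠ 0}), P n :=
          (tsum_image (fun n => P n) (rank_injOn Q)).symm
      _ = ∑' n, P n := by
          refine tsum_subtype_eq_of_support_subset (f := fun n => P n) fun n hn => ?_
          obtain ⟨x, hx, hxn⟩ := exists_rank_eq (P := Q) (n := n) fun h0 => hn (h n h0)
          exact ⟨x, hx, hxn⟩
      _ = 1 := P.tsum_coe
  refine ⟨mkPMF _ hsum, fun x hx => by simp [hx], fun x hx => by simp [hx], ?_⟩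
  refine rearr_congr fun t => ?_
  have himage : {n | t < P n} = rank Q '' {x | t < mkPMF _ hsum x} := by
    ext n
    simp only [mkPMF_apply, Set.mem_ofPred_eq, Set.mem_image]
    constructor
    · intro hn
      obtain ⟨x, hx, rfl⟩ := exists_rank_eq (P := Q) (n := n) fun h0 => by
        rw [h n h0] at hn
        exact not_lt_bot hn
      exact ⟨x, by simpa [hx] using hn, rfl⟩
    · rintro ⟨x, hx, rfl⟩
      split_ifs at hx
      · exact hx
      · exact absurd hx not_lt_bot
  rw [himage, ((rank_injOn Q).mono fun x hx => ?_).encard_image]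
  intro h0
  simp [h0] at hx

/-! ### Q as a mixture of arrangements of its Fano distribution -/

section Shape

variable {Q : PMF ℕ} {L j : ℕ} {c v w : ℝ} {K : ℕ∞}

/-- Any `L - j` ranks in `[j, K)` can receive the mass `v`. -/
theorem Shape.exists_arrangement (h : Shape Q L c j K v w) (s : Finset ℕ) (hcard : s.card = L - j)
    (hs : ∀ x ∈ s, j ≤ x ∧ (x : ℕ∞) < K) :
    ∃ R : PMF ℕ, rearr R = h.toPMF ∧ ∀ x, R x = if Q x = 0 then 0 else
      if rank Q x < j ∨ K ≤ rank Q x then Q x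
      else ENNReal.ofReal (if rank Q x ∈ s then v else w) := by
  classical
  have hjL := h.j_lt
  -- `σ` carries `s` onto `[j, L)`, where the Fano mass is `v`, and fixes every rank outside `[j,
  -- K)`.
  obtain ⟨σ, h1, h2⟩ := exists_perm_of_card_eq (A := {x : ℕ | j ≤ x ∧ (x : ℕ∞) < K})
    (Finset.Ico j L) s
    (fun x hx => by
      have := Finset.mem_Ico.1 (Finset.mem_coe.1 hx)
      exact ⟨this.1, lt_trans (by exact_mod_cast this.2) h.lt_K⟩)
    (fun x hx => hs x hx) (by rw [hcard, Nat.card_Ico])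
  have hA : ∀ x, (j ≤ x ∧ (x : ℕ∞) < K) → j ≤ σ x ∧ ((σ x : ℕ) : ℕ∞) < K := by
    intro x hx
    by_contra hcon
    have := h2 (σ x) hcon
    rw [σ.injective this] at hcon
    exact hcon hx
  have hval : ∀ n, permute σ h.toPMF n = if n < j ∨ K ≤ n then rearr Q n else
      ENNReal.ofReal (if n ∈ s then v else w) := by
    intro n
    change h.toPMF (σ n) = _
    rw [h.toPMF_apply, shapeMass]
    by_cases hn : n < j ∨ K ≤ n
    · have hnA : ¬ (j ≤ n ∧ (n : ℕ∞) < K) := by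
        rintro ⟨ha, hb⟩
        rcases hn with hn | hn
        · omega
        · exact absurd hb (not_lt.2 hn)
      rw [h2 n hnA, if_pos hn, if_pos hn, ENNReal.ofReal_toReal (apply_ne_top _ _)]
    · rw [if_neg hn]
      push Not at hn
      have hσ := hA n hn
      rw [if_neg (not_or.2 ⟨not_lt.2 hσ.1, not_le.2 hσ.2⟩)]
      have hiff : σ n < L ↔ n ∈ s := by
        rw [← h1 n, Finset.mem_Ico]
        exact ⟨fun h => ⟨hσ.1, h⟩, fun h => h.2⟩
      simp only [hiff]
  -- Below `K` the masses of Q↓ exceed `w ≥ 0`, so a zero mass in the range `[j, K)` is impossible.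
  obtain ⟨R, hR1, hR2, hR3⟩ := exists_pullback_rank Q (permute σ h.toPMF) (by
    intro n hn
    rw [hval]
    by_cases hn' : n < j ∨ K ≤ n
    · rw [if_pos hn', hn]
    · push Not at hn'
      have := h.w_lt n hn'.2
      rw [hn, ENNReal.toReal_zero] at this
      exact absurd this (not_lt.2 h.w_nonneg))
  refine ⟨R, ?_, fun x => ?_⟩
  · rw [hR3, rearr_permute, rearr_eq_self h.toPMF_antitone]
  · by_cases hx : Q x = 0
    · rw [if_pos hx, hR2 x hx]
    · rw [if_neg hx, hR1 x hx, hval, rearr_rank hx]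

/-- The inclusion probabilities for the ranks that receive the mass `v`. -/
def inclProb (Q : PMF ℕ) (j : ℕ) (K : ℕ∞) (v w : ℝ) (x : ℕ) : ℝ :=
  open Classical in
  if j ≤ x ∧ (x : ℕ∞) < K then ((rearr Q x).toReal - w) / (v - w) else 0

theorem Shape.inclProb_nonneg (h : Shape Q L c j K v w) (x : ℕ) : 0 ≤ inclProb Q j K v w x := by
  unfold inclProb
  split_ifs with hx
  · have h1 := h.w_lt x hx.2
    have h2 := h.w_lt_v
    exact div_nonneg (by linarith) (by linarith)
  · exact le_rfl

theorem Shape.inclProb_le_one (h : Shape Q L c j K v w) (x : ℕ) : inclProb Q j K v w x ≤ 1 := by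
  unfold inclProb
  split_ifs with hx
  · have h1 := h.lt_v
    have h2 := h.w_lt_v
    have h3 : (rearr Q x).toReal ≤ (rearr Q j).toReal := toReal_rearr_antitone Q hx.1
    rw [div_le_one (by linarith)]
    linarith
  · exact zero_le_one

theorem sum_inclProb {x : ℕ} (hjx : j ≤ x) (hx : (x : ℕ∞) ≤ K) :
    ∑ i ∈ Finset.range x, inclProb Q j K v w i
      = (topSum Q x - topSum Q j - ((x : ℝ) - j) * w) / (v - w) := by
  rw [← Finset.sum_range_add_sum_Ico _ hjx, Finset.sum_eq_zero, zero_add,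
    Finset.sum_congr rfl (g := fun i => ((rearr Q i).toReal - w) / (v - w)), ← Finset.sum_div,
    Finset.sum_sub_distrib, Finset.sum_Ico_eq_sub _ hjx, Finset.sum_const, Nat.card_Ico,
    nsmul_eq_mul, Nat.cast_sub hjx]
  · rfl
  · intro i hi
    have := Finset.mem_Ico.1 hi
    rw [inclProb, if_pos ⟨this.1, lt_of_lt_of_le (by exact_mod_cast this.2) hx⟩]
  · intro i hi
    have := Finset.mem_range.1 hi
    rw [inclProb, if_neg (by omega)]

/-- The probability `p` at rank `x` solves `p * v + (1 - p) * w = Q↓(x)`. The sum is `L - j` because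
Q↓ and the Fano distribution have the same total mass on `[j, K)`. -/
theorem Shape.hasSum_inclProb (h : Shape Q L c j K v w) :
    HasSum (inclProb Q j K v w) ((L - j : ℕ) : ℝ) := by
  have hwv := h.w_lt_v
  have hvw : v - w ≠ 0 := by linarith
  have hv := h.v_eq
  have hjL := h.j_lt
  rw [Nat.cast_sub hjL.le, hasSum_iff_tendsto_nat_of_nonneg h.inclProb_nonneg]
  rcases eq_or_ne K ⊤ with hK | hK
  · obtain ⟨hw, hc⟩ := h.of_top hK
    have hlim : Tendsto (fun x => (topSum Q x - topSum Q j) / v) atTop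
        (𝓝 ((1 - topSum Q j) / v)) := ((tendsto_topSum Q).sub_const _).div_const v
    have hv0 : v ≠ 0 := by rw [hw] at hwv; linarith
    have heq : (1 - topSum Q j) / v = (L : ℝ) - j := by
      rw [div_eq_iff hv0, ← hc, ← hv]; ring
    rw [heq] at hlim
    refine hlim.congr' ?_
    filter_upwards [eventually_ge_atTop j] with x hx
    rw [sum_inclProb hx (by rw [hK]; exact le_top), hw]
    simp
  · obtain ⟨k, rfl⟩ := ENat.ne_top_iff_exists.1 hK
    have hLk : L < k := by exact_mod_cast h.lt_K
    have hk := h.of_coe k rfl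
    refine tendsto_const_nhds.congr' ?_
    filter_upwards [eventually_ge_atTop k] with x hx
    rw [← Finset.sum_range_add_sum_Ico _ hx, sum_inclProb (by omega) le_rfl,
      Finset.sum_eq_zero (s := Finset.Ico k x), add_zero, eq_div_iff hvw, ← hk, ← hv]
    · ring
    · intro i hi
      have := (Finset.mem_Ico.1 hi).1
      rw [inclProb, if_neg]
      rintro ⟨-, h'⟩
      have : i < k := by exact_mod_cast h'
      omega

/-- `Q` is the mean of arrangements of the Fano distribution, given by the systematic sample. -/
theorem Shape.exists_mixture (h : Shape Q L c j K v w) :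
    ∃ κ : Finset ℕ → PMF ℕ,
      (∀ t ∈ Set.Ico (0 : ℝ) 1, rearr (κ (sample (inclProb Q j K v w) t)) = h.toPMF) ∧
      ∀ x, ∫⁻ t, κ (sample (inclProb Q j K v w) t) x ∂unif = Q x := by
  classical
  set p := inclProb Q j K v w with hp
  have h0 : ∀ x, 0 ≤ p x := h.inclProb_nonneg
  have h1 : ∀ x, p x ≤ 1 := h.inclProb_le_one
  have hs : HasSum p ((L - j : ℕ) : ℝ) := h.hasSum_inclProb
  -- For sets that are not admissible samples `Q` serves as a default; no `t` in `[0, 1)` produces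
  -- one.
  have harr : ∀ s : Finset ℕ, ∃ R : PMF ℕ,
      (s.card = L - j ∧ ∀ x ∈ s, j ≤ x ∧ (x : ℕ∞) < K) → rearr R = h.toPMF ∧
      ∀ x, R x = if Q x = 0 then 0 else
        if rank Q x < j ∨ K ≤ rank Q x then Q x
        else ENNReal.ofReal (if rank Q x ∈ s then v else w) := by
    intro s
    by_cases hs : s.card = L - j ∧ ∀ x ∈ s, j ≤ x ∧ (x : ℕ∞) < K
    · obtain ⟨R, hR⟩ := h.exists_arrangement s hs.1 hs.2
      exact ⟨R, fun _ => hR⟩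
    · exact ⟨Q, fun h => absurd h hs⟩
  choose κ hκ using harr
  have hok : ∀ t ∈ Set.Ico (0 : ℝ) 1, (sample p t).card = L - j ∧
      ∀ x ∈ sample p t, j ≤ x ∧ (x : ℕ∞) < K := by
    intro t ht
    refine ⟨card_sample h0 h1 hs ht, fun x hx => ?_⟩
    by_contra hcon
    refine ne_zero_of_mem_sampleSet ((mem_sample h0 h1 hs ht).1 hx) ?_
    rw [hp, inclProb, if_neg hcon]
  refine ⟨κ, fun t ht => (hκ _ (hok t ht)).1, fun x => ?_⟩
  have hae : ∀ᵐ t ∂unif, κ (sample p t) x = if Q x = 0 then 0 else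
      if rank Q x < j ∨ K ≤ rank Q x then Q x
      else ENNReal.ofReal (if rank Q x ∈ sampleSet p t then v else w) := by
    filter_upwards [ae_unif_mem] with t ht
    rw [(hκ _ (hok t ht)).2 x]
    simp only [mem_sample h0 h1 hs ht]
  rw [lintegral_congr_ae hae]
  by_cases hx : Q x = 0
  · simp [hx]
  by_cases hr : rank Q x < j ∨ K ≤ rank Q x
  · simp [hx, hr]
  simp only [hx, hr, if_false]
  have hwv := h.w_lt_v
  have hw0 := h.w_nonneg
  have hm := measurableSet_mem_sampleSet p (rank Q x)
  have hsplit : ∀ t, ENNReal.ofReal (if rank Q x ∈ sampleSet p t then v else w)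
      = ENNReal.ofReal w
        + {t | rank Q x ∈ sampleSet p t}.indicator (fun _ => ENNReal.ofReal (v - w)) t := by
    intro t
    by_cases ht : rank Q x ∈ sampleSet p t
    · rw [if_pos ht, Set.indicator_of_mem (by exact ht), ← ENNReal.ofReal_add hw0 (by linarith)]
      congr 1; ring
    · rw [if_neg ht, Set.indicator_of_notMem (by exact ht), add_zero]
  simp only [hsplit]
  rw [lintegral_add_left measurable_const, lintegral_const, measure_univ, mul_one,
    lintegral_indicator hm, setLIntegral_const, unif_mem_sampleSet h0 h1,
    ← ENNReal.ofReal_mul (by linarith), ← ENNReal.ofReal_add hw0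
      (mul_nonneg (by linarith) (h0 _))]
  push Not at hr
  rw [hp, inclProb, if_pos hr, mul_div_cancel₀ _ (by linarith : v - w ≠ 0), add_sub_cancel,
    rearr_rank hx, ENNReal.ofReal_toReal (apply_ne_top _ _)]

/-- The supremum is attained if `𝒴` has enough points to hold the values of the sample. -/
theorem Shape.le_supInfo {ε : ℝ} (h : Shape Q L (1 - ε) j K v w) (hL : 1 ≤ L) (hε : ε ≤ 1)
    {φ : PMF ℕ → ℝ≥0∞} (hs : IsSymmetric φ) {𝒴 : Type u} [MeasurableSpace 𝒴]
    [MeasurableSingletonClass 𝒴] (e : Finset ℕ → 𝒴)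
    (he : Set.InjOn e (sample (inclProb Q j K v w) '' Set.Ico 0 1)) :
    φ h.toPMF ≤ supInfo φ Q L ε 𝒴 := by
  classical
  obtain ⟨κ, h1, h2⟩ := h.exists_mixture
  set τ := sample (inclProb Q j K v w) with hτ
  let _ : MeasurableSpace (Finset ℕ) := ⊤
  have hτm : Measurable τ := measurable_sample _
  have hem : Measurable fun t => e (τ t) := measurable_from_top.comp hτm
  set S := τ '' Set.Ico 0 1 with hS
  -- Off the image of the samples the kernel is the constant `Q`; the image is countable, which
  -- makes `κ'` measurable.
  set κ' : 𝒴 → PMF ℕ := fun y => if y ∈ e '' S then κ (Function.invFunOn e S y) else Q with hκ'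
  have hκe : ∀ t ∈ Set.Ico (0 : ℝ) 1, κ' (e (τ t)) = κ (τ t) := by
    intro t ht
    have hmem : τ t ∈ S := ⟨t, ht, rfl⟩
    have hmem' : e (τ t) ∈ e '' S := ⟨_, hmem, rfl⟩
    simp only [hκ']
    rw [if_pos hmem']
    congr 1
    exact he (Function.invFunOn_mem hmem') hmem (Function.invFunOn_eq hmem')
  have hκm : ∀ x, Measurable fun y => κ' y x := by
    intro x
    refine Measurable.measurable_of_countable_ne (f := fun _ => Q x) measurable_const ?_
    refine ((Set.to_countable S).image e).mono fun y hy => ?_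
    by_contra hcon
    exact hy (by simp only [hκ']; rw [if_neg hcon])
  have := Measure.isProbabilityMeasure_map (μ := unif) hem.aemeasurable
  refine h.isExtremal.le_supInfo hL hε hs (unif.map fun t => e (τ t)) κ' hκm (fun x => ?_) ?_
  · rw [lintegral_map (hκm x) hem, ← h2 x]
    refine lintegral_congr_ae ?_
    filter_upwards [ae_unif_mem] with t ht
    rw [hκe t ht]
  · have hall : ∀ x, ∀ᵐ y ∂(unif.map fun t => e (τ t)), rearr (κ' y) x = h.toPMF x := fun x => by
      refine (ae_map_iff hem.aemeasurable (measurableSet_eq_fun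
        (measurable_rearr hκm x) measurable_const)).2 ?_
      filter_upwards [ae_unif_mem] with t ht
      rw [hκe t ht, h1 t ht]
    filter_upwards [ae_all_iff.2 hall] with y hy
    exact PMF.ext hy

/-- `Finset ℕ` is countable, so an infinite 𝒴 can hold every sample. -/
theorem Shape.le_supInfo_of_infinite {ε : ℝ} (h : Shape Q L (1 - ε) j K v w) (hL : 1 ≤ L)
    (hε : ε ≤ 1) {φ : PMF ℕ → ℝ≥0∞} (hs : IsSymmetric φ) {𝒴 : Type u} [MeasurableSpace 𝒴]
    [MeasurableSingletonClass 𝒴] [Infinite 𝒴] : φ h.toPMF ≤ supInfo φ Q L ε 𝒴 := by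
  obtain ⟨f, hf⟩ := exists_injective_nat (Finset ℕ)
  exact h.le_supInfo hL hε hs (fun s => Infinite.natEmbedding 𝒴 (f s))
    ((Infinite.natEmbedding 𝒴).injective.comp hf).injOn

/-- A sample is labelled by its class among the `k - j` provided by `exists_sample_classes`, and the
label determines the sample. -/
theorem Shape.le_supInfo_of_card {ε : ℝ} {k : ℕ} (h : Shape Q L (1 - ε) j k v w) (hL : 1 ≤ L)
    (hε : ε ≤ 1) {φ : PMF ℕ → ℝ≥0∞} (hs : IsSymmetric φ) {𝒴 : Type u} [MeasurableSpace 𝒴]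
    [MeasurableSingletonClass 𝒴] (hcard : ((k - j : ℕ) : Cardinal.{u}) ≤ Cardinal.mk 𝒴) :
    φ h.toPMF ≤ supInfo φ Q L ε 𝒴 := by
  classical
  have hLk : L < k := by exact_mod_cast h.lt_K
  have hjL := h.j_lt
  obtain ⟨g, hg⟩ := exists_sample_classes (p := inclProb Q j k v w) (show j < k by omega)
    (fun x hx => by rw [inclProb, if_neg (by omega)])
    (fun x hx => by
      rw [inclProb, if_neg]
      rintro ⟨-, h'⟩
      have : x < k := by exact_mod_cast h'
      omega) h.hasSum_inclProb
  obtain ⟨i⟩ : Nonempty (ULift.{u} (Fin (k - j)) ↪ 𝒴) := by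
    rw [← Cardinal.le_def]
    simpa using hcard
  set τ := sample (inclProb Q j k v w) with hτ
  refine h.le_supInfo hL hε hs
    (fun s => i ⟨g (Function.invFunOn τ (Set.Ico 0 1) s)⟩) fun s hs s' hs' heq => ?_
  have h1 := congrArg ULift.down (i.injective heq)
  have h2 := hg _ (Function.invFunOn_mem hs) _ (Function.invFunOn_mem hs') h1
  rwa [Function.invFunOn_eq (f := τ) hs, Function.invFunOn_eq (f := τ) hs'] at h2

end Shape

theorem le_choose {n m : ℕ} (h1 : 1 ≤ m) (h2 : m < n) : n ≤ n.choose m := by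
  induction n generalizing m with
  | zero => omega
  | succ n ih =>
    obtain ⟨m, rfl⟩ : ∃ i, m = i + 1 := ⟨m - 1, by omega⟩
    rw [Nat.choose_succ_succ']
    have hpos : 0 < n.choose (m + 1) := Nat.choose_pos (by omega)
    rcases Nat.eq_zero_or_pos m with rfl | hm
    · simp [add_comm]
    · have := ih hm (by omega)
      omega

/-- A constant `Y` leaves the posterior equal to `Q`. -/
theorem le_supInfo_of_eq_rearr {Q : PMF ℕ} {L : ℕ} {ε : ℝ} (hP₁ : IsExtremal Q L ε (rearr Q))
    (hL : 1 ≤ L) (hε : ε ≤ 1) {φ : PMF ℕ → ℝ≥0∞} (hs : IsSymmetric φ) {𝒴 : Type u}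
    [MeasurableSpace 𝒴] [Nonempty 𝒴] : φ (rearr Q) ≤ supInfo φ Q L ε 𝒴 := by
  obtain ⟨y⟩ := ‹Nonempty 𝒴›
  exact hP₁.le_supInfo hL hε hs (Measure.dirac y) (fun _ => Q) (fun _ => measurable_const)
    (fun x => by simp) (Eventually.of_forall fun _ => rfl)

/-- With n = K₁ - J + 1 the minimum in ♠ is at least n: `le_choose` bounds the binomial coefficient,
and n - 1 ≤ (n - 1)² the other term. -/
theorem natCast_le_of_spade {Q : PMF ℕ} {L k : ℕ} {ε : ℝ} {𝒴 : Type u} (hJ : 1 ≤ J Q L ε)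
    (hJL : J Q L ε - 1 < L) (hLk : L < k) (hk : K Q L ε = k) (h : Spade Q L ε 𝒴) :
    ((k - (J Q L ε - 1) : ℕ) : Cardinal.{u}) ≤ Cardinal.mk 𝒴 := by
  obtain ⟨k', hk', hle⟩ := h
  rw [hk] at hk'
  obtain rfl : k = k' := by exact_mod_cast hk'
  refine le_trans ?_ hle
  rw [Nat.cast_le, le_min_iff]
  constructor
  · have := le_choose (n := k + 1 - J Q L ε) (m := L + 1 - J Q L ε) (by omega) (by omega)
    omega
  · have h1 : k - (J Q L ε - 1) = (k - J Q L ε) + 1 := by omega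
    rw [h1]
    have := Nat.le_self_pow two_ne_zero (k - J Q L ε)
    omega

end Fano

end

/-! ### Assembly of the theorem -/

theorem theorem1 (Q : PMF ℕ) (L : ℕ) (hL : 1 ≤ L) (ε : ℝ) (𝒴 : Type u)
    (hε : Fano.InRange Q L ε 𝒴) :
    ∃ P₁ : PMF ℕ, Fano.IsFanoType1 Q L ε P₁ ∧
      (∀ (_ : MeasurableSpace 𝒴) (φ : PMF ℕ → ℝ≥0∞),
        Fano.IsSymmetric φ → Fano.IsConcave φ → Fano.IsLSC φ →
        -- the Fano-type inequality
        Fano.supInfo φ Q L ε 𝒴 ≤ φ P₁ ∧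
        -- four sufficient conditions for equality
        (StandardBorelSpace 𝒴 →
          (ε = Fano.marginalError Q L ∨
            (Fano.Spade Q L ε 𝒴 ∧ 0 < ε ∧ ε < Fano.marginalError Q L) ∨
            (Fano.Spade Q L ε 𝒴 ∧ Q.support.Finite) ∨
            (Fano.J Q L ε = L ∧ Cardinal.mk 𝒴 = Cardinal.aleph0)) →
          Fano.supInfo φ Q L ε 𝒴 = φ P₁) ∧
        -- a pair with almost surely constant rearranged posterior `P₁` is optimal
        (∀ (Ω : Type v) (_ : MeasurableSpace Ω) (μ : Measure Ω) (_ : IsProbabilityMeasure μ)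
          (X : Ω → ℕ) (Y : Ω → 𝒴), Measurable X → Measurable Y → μ.map X = Q.toMeasure →
          Fano.IsSharp P₁ X Y μ →
          Fano.Feasible Q L ε X Y μ ∧ Fano.condInfo φ X Y μ = Fano.supInfo φ Q L ε 𝒴 ∧
            Fano.supInfo φ Q L ε 𝒴 = φ P₁) ∧
        -- under strict concavity this characterizes the pairs attaining equality
        (Fano.IsStrict φ → φ P₁ ≠ ∞ →
          ∀ (Ω : Type v) (_ : MeasurableSpace Ω) (μ : Measure Ω) (_ : IsProbabilityMeasure μ)
          (X : Ω → ℕ) (Y : Ω → 𝒴), Measurable X → Measurable Y → μ.map X = Q.toMeasure →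
          ((Fano.Feasible Q L ε X Y μ ∧ Fano.condInfo φ X Y μ = Fano.supInfo φ Q L ε 𝒴 ∧
            Fano.supInfo φ Q L ε 𝒴 = φ P₁) ↔ Fano.IsSharp P₁ X Y μ))) ∧
      -- for `|𝒴| ≥ 𝔠` a suitable σ-algebra gives equality
      (Cardinal.continuum ≤ Cardinal.mk 𝒴 →
        ∃ _ : MeasurableSpace 𝒴, ∀ φ : PMF ℕ → ℝ≥0∞,
          Fano.IsSymmetric φ → Fano.IsConcave φ → Fano.IsLSC φ →
          Fano.supInfo φ Q L ε 𝒴 = φ P₁) := by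
  have h0 : 0 ≤ ε := Fano.nonneg_of_inRange hε
  have hne : Nonempty 𝒴 := Fano.nonempty_of_inRange hL hε
  have h1 : ε ≤ 1 := by
    have h := hε.2
    rw [Fano.marginalError_eq] at h
    have : 0 ≤ Fano.topSum Q L := Finset.sum_nonneg fun _ _ => ENNReal.toReal_nonneg
    linarith
  obtain ⟨P₁, hF, hE, hcase⟩ := Fano.exists_isFanoType1 hL h0 hε.2
  have hsharp : ∀ (_ : MeasurableSpace 𝒴) (φ : PMF ℕ → ℝ≥0∞), Fano.IsSymmetric φ →
      Fano.IsConcave φ → Fano.IsLSC φ → ∀ (Ω : Type v) (_ : MeasurableSpace Ω) (μ : Measure Ω)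
      (_ : IsProbabilityMeasure μ) (X : Ω → ℕ) (Y : Ω → 𝒴), Measurable X → Measurable Y →
      μ.map X = Q.toMeasure → Fano.IsSharp P₁ X Y μ →
      Fano.Feasible Q L ε X Y μ ∧ Fano.condInfo φ X Y μ = Fano.supInfo φ Q L ε 𝒴 ∧
        Fano.supInfo φ Q L ε 𝒴 = φ P₁ := by
    intro _ φ hs hc hl Ω _ μ _ X Y hX hY hQ hS
    have heq : Fano.supInfo φ Q L ε 𝒴 = φ P₁ := le_antisymm (hE.supInfo_le h0 hs hc hl 𝒴)
      (hE.le_supInfo_of_isSharp hL h1 hs hX hY hQ hS)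
    exact ⟨hE.feasible_of_isSharp hL h1 hX hY hQ hS, by rw [heq, hS.condInfo_eq hs], heq⟩
  refine ⟨P₁, hF, fun m𝒴 φ hs hc hl => ⟨hE.supInfo_le h0 hs hc hl 𝒴, fun hB hcond => ?_,
    hsharp m𝒴 φ hs hc hl, fun hst hfin Ω _ μ _ X Y hX hY hQ => ⟨fun h => ?_, fun h => ?_⟩⟩,
    fun hcard => ⟨⊤, fun φ hs hc hl => ?_⟩⟩
  · refine le_antisymm (hE.supInfo_le h0 hs hc hl 𝒴) ?_
    rcases hcase with rfl | ⟨hlt, v, w, hsh, rfl⟩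
    · exact Fano.le_supInfo_of_eq_rearr hE hL h1 hs
    have hspade : Fano.Spade Q L ε 𝒴 → φ hsh.toPMF ≤ Fano.supInfo φ Q L ε 𝒴 := by
      intro hsp
      obtain ⟨k, hk, -⟩ := id hsp
      have hLk : L < k := by
        have := hsh.lt_K
        rw [hk] at this
        exact_mod_cast this
      have hle := Fano.natCast_le_of_spade (Fano.J_mem Q hL ε).1 hsh.j_lt hLk hk hsp
      clear hcond
      revert hsh
      rw [hk]
      intro hsh _ _ _
      exact hsh.le_supInfo_of_card hL h1 hs hle
    rcases hcond with h | h | h | h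
    · exact absurd h hlt.ne
    · exact hspade h.1
    · exact hspade h.1
    · have : Infinite 𝒴 := Cardinal.infinite_iff.2 h.2.ge
      exact hsh.le_supInfo_of_infinite hL h1 hs
  · exact hE.isSharp h0 hs hc hl hst hfin h.1 (h.2.1.trans h.2.2)
  · exact hsharp m𝒴 φ hs hc hl Ω inferInstance μ inferInstance X Y hX hY hQ h
  -- With the discrete σ-algebra singletons are measurable, and the construction charges only
  -- countably many points.
  · let _ : MeasurableSpace 𝒴 := ⊤
    have : MeasurableSingletonClass 𝒴 := ⟨fun _ => trivial⟩
    refine le_antisymm (hE.supInfo_le h0 hs hc hl 𝒴) ?_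
    rcases hcase with rfl | ⟨hlt, v, w, hsh, rfl⟩
    · exact Fano.le_supInfo_of_eq_rearr hE hL h1 hs
    · have : Infinite 𝒴 := Cardinal.infinite_iff.2 (Cardinal.aleph0_le_continuum.trans hcard)
      exact hsh.le_supInfo_of_infinite hL h1 hs
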